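/- Let $H:\mathbb R^2\times\mathbb R\to\mathbb R$, $(z,u)\mapsto H(z,u)$ with $z=(x,y)$, be a smooth function, and consider the pp-wave $(\mathbb R^4,g)$ with global coordinates $(x,y,u,v)$ and Lorentzian metric $$g=dx^2+dy^2+2\,du\,dv+H(z,u)\,du^2 .$$ Assume that $g$ is Ricci flat and that $H$ is polynomially $u$-bounded, i.e. for each $u_0\in\mathbb R$ there exist $\epsilon_0>0$ and a polynomial $q_0$ on $\mathbb R^2$ such that $H(z,u)\le q_0(z)$ for all $(z,u)\in\mathbb R^2\times(u_0-\epsilon_0,u_0+\epsilon_0)$. Then $(\mathbb R^4,g)$ is geodesically complete (every geodesic defined on an open interval extends to a geodesic defined on all of $\mathbb R$) if and only if it is a plane wave, i.e. for each $u\in\mathbb R$ the function $z=(x,y)\mapsto H(z,u)$ is a polynomial in $x,y$ of degree at most $2$. -/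

import Mathlib

open scoped ContDiff

/-- The partial derivative `∂ᵢ f` at `p` of a real function on `ℝⁿ`. -/
noncomputable def partialDeriv {n : ℕ} (i : Fin n) (f : (Fin n → ℝ) → ℝ) (p : Fin n → ℝ) : ℝ :=
  fderiv ℝ f p (Pi.single i 1)

/-- The Christoffel symbol `Γᵏᵢⱼ = ½ ∑ₗ gᵏˡ (∂ᵢ gⱼₗ + ∂ⱼ gᵢₗ - ∂ₗ gᵢⱼ)` at `p` of the
(Levi-Civita connection of the) pseudo-Riemannian metric on `ℝⁿ` whose component matrix in the
global coordinates is `g`. -/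
noncomputable def christoffel {n : ℕ} (g : (Fin n → ℝ) → Matrix (Fin n) (Fin n) ℝ)
    (k i j : Fin n) (p : Fin n → ℝ) : ℝ :=
  (1 / 2) * ∑ l, (g p)⁻¹ k l *
    (partialDeriv i (fun q => g q j l) p + partialDeriv j (fun q => g q i l) p
      - partialDeriv l (fun q => g q i j) p)

/-- The component `Rᵢⱼ = ∑ₖ (∂ₖ Γᵏᵢⱼ - ∂ⱼ Γᵏᵢₖ) + ∑ₖₗ (Γᵏₖₗ Γˡᵢⱼ - Γᵏⱼₗ Γˡᵢₖ)` of the Ricci tensor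
of the metric `g` at `p`. -/
noncomputable def ricci {n : ℕ} (g : (Fin n → ℝ) → Matrix (Fin n) (Fin n) ℝ)
    (i j : Fin n) (p : Fin n → ℝ) : ℝ :=
  (∑ k, (partialDeriv k (christoffel g k i j) p - partialDeriv j (christoffel g k i k) p)) +
    ∑ k, ∑ l, (christoffel g k k l p * christoffel g l i j p
      - christoffel g k j l p * christoffel g l i k p)

/-- The metric `g` is Ricci flat: its Ricci tensor vanishes identically. -/
def IsRicciFlat {n : ℕ} (g : (Fin n → ℝ) → Matrix (Fin n) (Fin n) ℝ) : Prop :=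
  ∀ p i j, ricci g i j p = 0

/-- The curve `γ` is a geodesic of `g` on the open set `I` of parameters: it is twice
differentiable there and `γ̈ᵏ = - ∑ᵢⱼ Γᵏᵢⱼ(γ) γ̇ⁱ γ̇ʲ`. -/
def IsGeodesicOn {n : ℕ} (g : (Fin n → ℝ) → Matrix (Fin n) (Fin n) ℝ)
    (γ : ℝ → Fin n → ℝ) (I : Set ℝ) : Prop :=
  ∀ s ∈ I, DifferentiableAt ℝ γ s ∧
    HasDerivAt (deriv γ)
      (fun k => - ∑ i, ∑ j, christoffel g k i j (γ s) * deriv γ s i * deriv γ s j) s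

/-- The metric `g` on `ℝⁿ` is geodesically complete: every geodesic, defined on a nonempty open
interval, is the restriction of a geodesic defined on the whole real line (so that the
inextensible geodesics are those defined on all of `ℝ`). -/
def IsGeodesicallyComplete {n : ℕ} (g : (Fin n → ℝ) → Matrix (Fin n) (Fin n) ℝ) : Prop :=
  ∀ (I : Set ℝ) (γ : ℝ → Fin n → ℝ), IsOpen I → I.OrdConnected → I.Nonempty →
    IsGeodesicOn g γ I → ∃ γ' : ℝ → Fin n → ℝ, IsGeodesicOn g γ' Set.univ ∧ Set.EqOn γ' γ I

/-- The pp-wave metric `g = dx² + dy² + 2 du dv + H(z,u) du²`, `z = (x, y)`, on `ℝ⁴` with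
coordinates `(x, y, u, v)` numbered `0, 1, 2, 3`. -/
def ppWaveMetric (H : (Fin 2 → ℝ) × ℝ → ℝ) (p : Fin 4 → ℝ) : Matrix (Fin 4) (Fin 4) ℝ :=
  !![1, 0, 0, 0;
     0, 1, 0, 0;
     0, 0, H (![p 0, p 1], p 2), 1;
     0, 0, 1, 0]

/-- The pp-wave with coefficient `H` is a plane wave: at each `u`, the function `H(·, u)` is a
polynomial of degree at most `2` in `z = (x, y)`. -/
def IsPlaneWave (H : (Fin 2 → ℝ) × ℝ → ℝ) : Prop :=
  ∀ u : ℝ, ∃ q : MvPolynomial (Fin 2) ℝ, q.totalDegree ≤ 2 ∧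
    ∀ z : Fin 2 → ℝ, H (z, u) = MvPolynomial.eval z q

/-- `H` is polynomially `u`-bounded (polynomially upper bounded along finite `u`-times). -/
def PolynomiallyUBounded (H : (Fin 2 → ℝ) × ℝ → ℝ) : Prop :=
  ∀ u₀ : ℝ, ∃ ε₀ : ℝ, 0 < ε₀ ∧ ∃ q₀ : MvPolynomial (Fin 2) ℝ,
    ∀ (z : Fin 2 → ℝ), ∀ u ∈ Set.Ioo (u₀ - ε₀) (u₀ + ε₀), H (z, u) ≤ MvPolynomial.eval z q₀

/-!
In the global coordinates `u̇` is constant along a geodesic, `v` is obtained from the other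
coordinates by quadrature, and `z = x + i y` satisfies `z̈ = (u̇² / 2) conj (G(z, u))`, where
`G = ∂ₓH - i ∂ᵧH`. Ricci flatness says that every `H(·, u)` is harmonic, so that `G(·, u)` is entire;
its Taylor coefficients `ppTaylorCoeff H k u` at `z = 0` are continuous in `u` by Cauchy's formula.
If `H(·, u)` is bounded above by a polynomial of degree `N`, the Borel-Carathéodory inequality and
Cauchy's estimates show that the coefficients with `k ≥ N` vanish (`ppTaylorCoeff_eq_zero`). Being a
plane wave thus means that `G(·, u)` is affine for all `u`.

For a plane wave the equation for `z` is real linear with continuous coefficients, hence has global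
solutions (`exists_solution_of_lipschitzWith`), and uniqueness identifies a given geodesic with the
restriction of a global one.

Conversely, suppose that some coefficient of order at least `2` is not zero. By the bound on `H`,
locally uniform in `u`, there are an interval and a largest order `n ≥ 2` of a coefficient that does
not vanish identically on it; fix `u₀` there with nonzero coefficient of order `n`. After a rotation
of the `z`-plane this coefficient is a positive number `A`. Near `u = u₀` and far out in a thin cone
around the positive real axis the force is then a small relative perturbation of
`½ A conj (zⁿ)`: it pushes outwards like `xⁿ`, and since the axis is a minimum of the potential in
the angular direction it pushes back towards the axis. With `m = n + 1` and the time `τ` given by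
`dτ = x ^ ((m - 2) / 2) ds`, the angle obeys a damped oscillator equation with small forcing, whose
solutions are trapped by a Lyapunov function (`exists_lyapunov`). A particle that starts on the axis,
far out and with velocity comparable to `x ^ (m / 2)`, therefore stays in the cone and satisfies
`ẋ ≥ const * x ^ (m / 2)` with `m ≥ 3`, so that it cannot exist for longer than an arbitrarily short
prescribed time (`exists_forall_false_of_radial_force`, `exists_initial_data_false`). Such a particle
comes from a short geodesic with `u̇ = 1` (`exists_isGeodesicOn_Ioo`), which hence has no extension to
the real line.
-/

/-! ### Barriers and a Lyapunov function -/

/-- If each member of a finite family of real functions is negative at `0` and has a negative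
derivative whenever it vanishes while no member is positive, then all members stay negative. The
distinguished member `i₀` guards the domain on which the others are differentiable. -/
theorem forall_neg_of_barrier {ι : Type*} [Finite ι] (i₀ : ι) {φ φ' : ι → ℝ → ℝ} {δ : ℝ}
    (h0 : ∀ i, φ i 0 < 0)
    (hcont : ContinuousOn (φ i₀) (Set.Icc 0 δ))
    (hd : ∀ s ∈ Set.Icc 0 δ, φ i₀ s ≤ 0 → ∀ i, HasDerivAt (φ i) (φ' i s) s)
    (hneg : ∀ s ∈ Set.Icc 0 δ, (∀ j, φ j s ≤ 0) → ∀ i, φ i s = 0 → φ' i s < 0) :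
    ∀ s ∈ Set.Icc 0 δ, ∀ i, φ i s < 0 := by
  classical
  by_contra! hcon
  obtain ⟨s₁, hs₁, i₁, hi₁⟩ := hcon
  set S : Set ℝ := {s | s ∈ Set.Icc 0 δ ∧ ∃ i, 0 ≤ φ i s} with hS
  have hSne : S.Nonempty := ⟨s₁, hs₁, i₁, hi₁⟩
  have hSbd : BddBelow S := ⟨0, fun s hs => hs.1.1⟩
  set t := sInf S with ht
  have ht0 : 0 ≤ t := le_csInf hSne fun s hs => hs.1.1
  have htδ : t ≤ δ := (csInf_le hSbd ⟨hs₁, i₁, hi₁⟩).trans hs₁.2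
  have htI : t ∈ Set.Icc 0 δ := ⟨ht0, htδ⟩
  have hbefore : ∀ s, 0 ≤ s → s < t → ∀ i, φ i s < 0 := by
    intro s hs0 hst i
    by_contra! h
    exact absurd (csInf_le hSbd (show s ∈ S from ⟨⟨hs0, hst.le.trans htδ⟩, i, h⟩)) (not_le.2 hst)
  -- A member continuous at `t` from the left is nonpositive at `t`.
  have hle : ∀ i, ContinuousWithinAt (φ i) (Set.Icc 0 δ) t → φ i t ≤ 0 := by
    intro i hi
    rcases eq_or_lt_of_le ht0 with h | h
    · rw [← h]; exact (h0 i).le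
    · have h1 : ContinuousWithinAt (φ i) (Set.Ico 0 t) t :=
        hi.mono fun s hs => ⟨hs.1, hs.2.le.trans htδ⟩
      have : t ∈ closure (Set.Ico 0 t) := by
        rw [closure_Ico h.ne]; exact ⟨ht0, le_rfl⟩
      have hne : (nhdsWithin t (Set.Ico 0 t)).NeBot := mem_closure_iff_nhdsWithin_neBot.1 this
      exact le_of_tendsto h1 (Filter.eventually_of_mem self_mem_nhdsWithin
        fun s hs => (hbefore s hs.1 hs.2 i).le)
  have hd' := hd t htI (hle i₀ (hcont t htI))
  have hle' : ∀ i, φ i t ≤ 0 := fun i => hle i (hd' i).continuousAt.continuousWithinAt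
  by_cases hall : ∀ i, φ i t < 0
  · have hev : ∀ᶠ s in nhds t, ∀ i, φ i s < 0 :=
      Filter.eventually_all.2 fun i => (hd' i).continuousAt.eventually (gt_mem_nhds (hall i))
    obtain ⟨r, hr, hball⟩ := Metric.eventually_nhds_iff.1 hev
    obtain ⟨s, hs, hsr⟩ := exists_lt_of_csInf_lt hSne (show sInf S < t + r by linarith)
    have hts : t ≤ s := csInf_le hSbd hs
    obtain ⟨i, hi⟩ := hs.2
    have := hball (show dist s t < r by rw [Real.dist_eq, abs_of_nonneg] <;> linarith) i
    linarith
  · push Not at hall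
    obtain ⟨i, hi⟩ := hall
    have hi0 : φ i t = 0 := le_antisymm (hle' i) hi
    have hneg' := hneg t htI hle' i hi0
    have htpos : 0 < t := by
      rcases eq_or_lt_of_le ht0 with h | h
      · exact absurd (h ▸ hi0) (h0 i).ne
      · exact h
    -- A negative derivative at a zero forces positive values just before `t`.
    have hslope := (hasDerivAt_iff_tendsto_slope.1 (hd' i)).eventually (gt_mem_nhds hneg')
    have hslope' : ∀ᶠ s in nhdsWithin t (Set.Iio t), slope (φ i) t s < 0 :=
      hslope.filter_mono (nhdsWithin_mono _ fun s hs => ne_of_lt hs)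
    have hpos : ∀ᶠ s in nhdsWithin t (Set.Iio t), 0 < s :=
      (lt_mem_nhds htpos).filter_mono nhdsWithin_le_nhds
    obtain ⟨s, ⟨h1, h2⟩, h3⟩ :=
      ((hslope'.and hpos).and self_mem_nhdsWithin).exists
    have h4 := hbefore s h2.le h3 i
    rw [slope_def_field, hi0, sub_zero] at h1
    have h3' : s - t < 0 := sub_neg.2 h3
    have := div_pos_of_neg_of_neg h4 h3'
    linarith

/-- The algebra behind the Lyapunov function `Λ = q² + K P² + β P q` of the damped oscillator
`P' = q`, `q' = -K P - D q + e`: for damping `D` between two positive bounds and small `β`, the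
derivative of `Λ` is negative on the level set `Λ = K ε² / 2` for all forcings `e` with
`|e| ≤ c ε`. -/
theorem exists_lyapunov {K D₁ D₂ : ℝ} (hK : 0 < K) (hD₁ : 0 < D₁) :
    ∃ β c : ℝ, 0 < c ∧ (∀ P q : ℝ, q ^ 2 + K * P ^ 2 ≤ 2 * (q ^ 2 + K * P ^ 2 + β * P * q)) ∧
      ∀ ε > 0, ∀ P q D e : ℝ, D₁ ≤ D → D ≤ D₂ →
        |e| ≤ c * ε → q ^ 2 + K * P ^ 2 + β * P * q = K * ε ^ 2 / 2 →
        2 * q * (-K * P - D * q + e) + 2 * K * P * q +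
          β * (q * q + P * (-K * P - D * q + e)) < 0 := by
  set k := Real.sqrt K with hk
  have hk0 : 0 < k := Real.sqrt_pos.2 hK
  have hkk : K = k ^ 2 := (Real.sq_sqrt hK.le).symm
  obtain ⟨β, hβ0, hβk, hβD⟩ : ∃ β : ℝ, 0 < β ∧ β ≤ k ∧ β * (1 + D₂ ^ 2 / (2 * K)) ≤ D₁ := by
    have h1 : 0 < 1 + D₂ ^ 2 / (2 * K) := by positivity
    refine ⟨min k (D₁ / (1 + D₂ ^ 2 / (2 * K))), lt_min hk0 (by positivity), min_le_left _ _, ?_⟩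
    calc _ ≤ D₁ / (1 + D₂ ^ 2 / (2 * K)) * (1 + D₂ ^ 2 / (2 * K)) := by
          gcongr; exact min_le_right _ _
      _ = D₁ := by field_simp
  have hcomp : ∀ P q : ℝ, |β * P * q| ≤ (q ^ 2 + K * P ^ 2) / 2 := by
    intro P q
    rw [abs_mul, abs_mul, abs_of_pos hβ0]
    have h1 : β * |P| * |q| ≤ k * |P| * |q| := by gcongr
    have h2 : 0 ≤ (|q| - k * |P|) ^ 2 := sq_nonneg _
    rw [hkk]
    nlinarith [sq_abs q, sq_abs P]
  refine ⟨β, β * K / (12 * (2 * k + β)), by positivity, fun P q => ?_, ?_⟩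
  · have := neg_le_of_abs_le (hcomp P q)
    linarith
  intro ε hε P q D e h1 h2 he hΛ
  set c := β * K / (12 * (2 * k + β)) with hc
  have hc0 : 0 < c := by positivity
  have hcm := hcomp P q
  have hlow : K * ε ^ 2 / 3 ≤ q ^ 2 + K * P ^ 2 := by linarith [le_of_abs_le hcm]
  have hupp : q ^ 2 + K * P ^ 2 ≤ K * ε ^ 2 := by linarith [neg_le_of_abs_le hcm]
  have hP : |P| ≤ ε := by
    apply abs_le_of_sq_le_sq _ hε.le
    nlinarith [sq_nonneg q]
  have hq : |q| ≤ k * ε := by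
    apply abs_le_of_sq_le_sq _ (by positivity)
    rw [mul_pow, ← hkk]
    nlinarith [sq_nonneg P]
  have hforce : e * (2 * q + β * P) ≤ β * K * ε ^ 2 / 12 := by
    calc e * (2 * q + β * P) ≤ |e| * |2 * q + β * P| := by rw [← abs_mul]; exact le_abs_self _
      _ ≤ (c * ε) * (2 * (k * ε) + β * ε) := by
          gcongr
          calc |2 * q + β * P| ≤ |2 * q| + |β * P| := abs_add_le _ _
            _ = 2 * |q| + β * |P| := by
                rw [abs_mul, abs_mul, abs_of_pos hβ0, abs_of_pos (zero_lt_two (α := ℝ))]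
            _ ≤ _ := by gcongr
      _ = β * K * ε ^ 2 / 12 := by rw [hc]; field_simp
  have hD0 : 0 < D := hD₁.trans_le h1
  have hcross : -(β * D * P * q) ≤ β * K / 2 * P ^ 2 + β * (D₂ ^ 2 / (2 * K)) * q ^ 2 := by
    have h3 : β * K / 2 * P ^ 2 + β * (D ^ 2 / (2 * K)) * q ^ 2 + β * D * P * q
        = β / (2 * K) * (K * P + D * q) ^ 2 := by field_simp; ring
    have h4 : 0 ≤ β / (2 * K) * (K * P + D * q) ^ 2 := by positivity
    have h5 : β * (D ^ 2 / (2 * K)) * q ^ 2 ≤ β * (D₂ ^ 2 / (2 * K)) * q ^ 2 := by gcongr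
    linarith
  have hdamp : (β + β * (D₂ ^ 2 / (2 * K))) * q ^ 2 ≤ D * q ^ 2 := by
    apply mul_le_mul_of_nonneg_right _ (sq_nonneg q); linarith
  have hβD' : β ≤ D := by
    have : 0 ≤ β * (D₂ ^ 2 / (2 * K)) := by positivity
    linarith
  have h6 : β * q ^ 2 ≤ D * q ^ 2 := mul_le_mul_of_nonneg_right hβD' (sq_nonneg q)
  have h7 : 0 < β * K * ε ^ 2 := by positivity
  have h8 : β / 2 * (K * ε ^ 2 / 3) ≤ β / 2 * (q ^ 2 + K * P ^ 2) := by gcongr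
  have h9 : 0 ≤ β * q ^ 2 := by positivity
  nlinarith

/-! ### Blow-up in a radial force field -/

/-- The derivatives of the normalized radial velocity `x' / ρ ^ m`, angle `y / x` and angular
momentum `(x y' - y x') / ρ ^ (m + 2)`, where `ρ = √x` and `m = k + 3`. -/
theorem hasDerivAt_normalized {k : ℕ} {x y vx vy : ℝ → ℝ} {X Y s : ℝ} (hx : HasDerivAt x (vx s) s)
    (hy : HasDerivAt y (vy s) s) (hvx : HasDerivAt vx X s) (hvy : HasDerivAt vy Y s)
    (hpos : 0 < x s) :
    HasDerivAt (fun s => vx s / √(x s) ^ (k + 3))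
      (√(x s) ^ (k + 1) * (X / x s ^ (k + 2) -
        ((k + 3 : ℕ) : ℝ) / 2 * (vx s / √(x s) ^ (k + 3)) ^ 2)) s ∧
    HasDerivAt (fun s => y s / x s)
      (√(x s) ^ (k + 1) * ((x s * vy s - y s * vx s) / √(x s) ^ (k + 3 + 2))) s ∧
    HasDerivAt (fun s => (x s * vy s - y s * vx s) / √(x s) ^ (k + 3 + 2))
      (√(x s) ^ (k + 1) * ((x s * Y - y s * X) / x s ^ (k + 3) -
        (((k + 3 : ℕ) : ℝ) + 2) / 2 * (vx s / √(x s) ^ (k + 3)) *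
          ((x s * vy s - y s * vx s) / √(x s) ^ (k + 3 + 2)))) s := by
  have hρ := hx.sqrt hpos.ne'
  have hρ0 : √(x s) ≠ 0 := (Real.sqrt_pos.2 hpos).ne'
  have hx2 : x s = √(x s) ^ 2 := (Real.sq_sqrt hpos.le).symm
  refine ⟨?_, ?_, ?_⟩
  · refine (hvx.fun_div (hρ.fun_pow (k + 3)) (pow_ne_zero _ hρ0)).congr_deriv ?_
    generalize √(x s) = r at *
    rw [hx2, show k + 3 - 1 = k + 2 by omega]
    field_simp
    push_cast
    ring
  · refine (hy.fun_div hx hpos.ne').congr_deriv ?_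
    generalize √(x s) = r at *
    rw [hx2]
    field_simp
    ring
  · refine (((hx.fun_mul hvy).fun_sub (hy.fun_mul hvx)).fun_div (hρ.fun_pow (k + 3 + 2))
      (pow_ne_zero _ hρ0)).congr_deriv ?_
    generalize √(x s) = r at *
    rw [hx2, show k + 3 + 2 - 1 = k + 4 by omega]
    field_simp
    push_cast
    ring

/-- A function with `x' ≥ c x ^ ((k + 3) / 2)` and `x ≥ 1` blows up in a time bounded in terms of
`x 0`, because `1 / √x` decreases at a rate at least `c / 2`. -/
theorem false_of_superlinear_growth {k : ℕ} {c δ : ℝ} (hc : 0 < c) (hδ : 0 < δ) {x vx : ℝ → ℝ}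
    (hd : ∀ s ∈ Set.Icc 0 δ, HasDerivAt x (vx s) s) (hx : ∀ s ∈ Set.Icc 0 δ, 1 ≤ x s)
    (hvx : ∀ s ∈ Set.Icc 0 δ, c * √(x s) ^ (k + 3) ≤ vx s) (h0 : 4 / (c * δ) ^ 2 ≤ x 0) :
    False := by
  have hρ1 : ∀ s ∈ Set.Icc 0 δ, 1 ≤ √(x s) := fun s hs => Real.one_le_sqrt.2 (hx s hs)
  have hinv : ∀ s ∈ Set.Icc 0 δ, HasDerivAt (fun s => (√(x s))⁻¹ + c / 2 * s)
      (-(vx s / (2 * √(x s))) / √(x s) ^ 2 + c / 2) s := by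
    intro s hs
    have h1 := ((hd s hs).sqrt (zero_lt_one.trans_le (hx s hs)).ne').fun_inv
      (zero_lt_one.trans_le (hρ1 s hs)).ne'
    simpa using! h1.fun_add ((hasDerivAt_id s).const_mul (c / 2))
  have hanti : AntitoneOn (fun s => (√(x s))⁻¹ + c / 2 * s) (Set.Icc 0 δ) := by
    apply antitoneOn_of_hasDerivWithinAt_nonpos (convex_Icc 0 δ)
      (fun s hs => (hinv s hs).continuousAt.continuousWithinAt)
      (fun s hs => (hinv s (interior_subset hs)).hasDerivWithinAt)
    intro s hs
    have hs' := interior_subset hs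
    have h1 := hρ1 s hs'
    have h2 := hvx s hs'
    generalize √(x s) = r at *
    have hr : 0 < r := by linarith
    have h3 : c * r ^ 3 ≤ vx s := by
      refine le_trans ?_ h2
      gcongr
      omega
    have h4 : -(vx s / (2 * r)) / r ^ 2 = -(vx s / (2 * r ^ 3)) := by field_simp
    have h5 : c / 2 ≤ vx s / (2 * r ^ 3) := by
      rw [div_le_div_iff₀ (by positivity) (by positivity)]; linarith
    rw [h4]; linarith
  have hδI : δ ∈ Set.Icc 0 δ := Set.right_mem_Icc.2 hδ.le
  have hle := hanti (Set.left_mem_Icc.2 hδ.le) hδI hδ.le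
  simp only [mul_zero, add_zero] at hle
  have hpos : 0 < (√(x δ))⁻¹ := inv_pos.2 (zero_lt_one.trans_le (hρ1 δ hδI))
  have h6 : (√(x 0))⁻¹ ≤ c / 2 * δ := by
    have h7 : 0 < c * δ := by positivity
    have h8 : 2 / (c * δ) ≤ √(x 0) := by
      apply Real.le_sqrt_of_sq_le
      rw [div_pow]; norm_num; linarith
    calc (√(x 0))⁻¹ ≤ (2 / (c * δ))⁻¹ := by gcongr
      _ = c / 2 * δ := by rw [inv_div]; ring
  linarith

set_option maxHeartbeats 800000 in
/-- A motion `(x, y)` in the plane cannot exist up to time `δ` if it starts far out on the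
`x`-axis with radial velocity comparable to `x ^ (m / 2)` and if, in the cone `|y| ≤ ε x`, the
radial force is comparable to `x ^ (m - 1)` while the torque is up to a small error the restoring
torque `-(m A / 2) x ^ (m - 1) y`. The quantities `w = x' / x ^ (m / 2)`, `P = y / x` and
`q = (x y' - y x') / x ^ (m / 2 + 1)` are trapped by barriers; then `x' ≥ const * x ^ (m / 2)`,
so that `x ^ (-1 / 2)` reaches `0` before time `δ`. -/
theorem exists_forall_false_of_radial_force {m : ℕ} (hm : 3 ≤ m) {A : ℝ} (hA : 0 < A) :
    ∃ c > 0, ∀ ε > 0, ∀ δ > 0, ∃ R₁ > 0, ∀ R ≥ R₁, ∀ x y vx vy X Y : ℝ → ℝ,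
      (∀ s ∈ Set.Icc 0 δ, HasDerivAt x (vx s) s ∧ HasDerivAt y (vy s) s ∧
        HasDerivAt vx (X s) s ∧ HasDerivAt vy (Y s) s) →
      (∀ s ∈ Set.Icc 0 δ, R ≤ x s → |y s| ≤ ε * x s →
        |X s - A / 2 * x s ^ (m - 1)| ≤ A / 4 * x s ^ (m - 1) ∧
        |x s * Y s - y s * X s + m * A / 2 * x s ^ (m - 1) * y s| ≤ c * ε * x s ^ m) →
      x 0 = 2 * R → y 0 = 0 → vx 0 = Real.sqrt (A / m) * Real.sqrt (2 * R) ^ m → vy 0 = 0 →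
      False := by
  have hm0 : (0 : ℝ) < m := by exact_mod_cast (by omega : 0 < m)
  set w₁ := Real.sqrt (A / (4 * m)) with hw₁
  set w₂ := Real.sqrt (2 * A / m) with hw₂
  have hw₁0 : 0 < w₁ := Real.sqrt_pos.2 (by positivity)
  have hw₁2 : w₁ ^ 2 = A / (4 * m) := Real.sq_sqrt (by positivity)
  have hw₂0 : 0 < w₂ := Real.sqrt_pos.2 (by positivity)
  have hw₂2 : w₂ ^ 2 = 2 * A / m := Real.sq_sqrt (by positivity)
  set K := m * A / 2 with hK
  have hK0 : 0 < K := by positivity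
  obtain ⟨β, c, hc, hcoer, hlyap⟩ := exists_lyapunov (D₁ := (m + 2) / 2 * w₁)
    (D₂ := (m + 2) / 2 * w₂) hK0 (by positivity)
  refine ⟨c, hc, fun ε hε δ hδ => ?_⟩
  refine ⟨max 1 (4 / (w₁ * δ) ^ 2), by positivity, ?_⟩
  intro R hR x y vx vy X Y hd hforce hx0 hy0 hvx0 hvy0
  have hR1 : 1 ≤ R := (le_max_left _ _).trans hR
  have hR2 : 4 / (w₁ * δ) ^ 2 ≤ R := (le_max_right _ _).trans hR
  have hRpos : 0 < R := by linarith
  set ρ : ℝ → ℝ := fun s => Real.sqrt (x s) with hρ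
  set w : ℝ → ℝ := fun s => vx s / ρ s ^ m with hw
  set P : ℝ → ℝ := fun s => y s / x s with hP
  set q : ℝ → ℝ := fun s => (x s * vy s - y s * vx s) / ρ s ^ (m + 2) with hq
  set Λ : ℝ → ℝ := fun s => q s ^ 2 + K * P s ^ 2 + β * P s * q s with hΛ
  set e : ℝ → ℝ := fun s => (x s * Y s - y s * X s) / x s ^ m + K * P s with he
  set D : ℝ → ℝ := fun s => (m + 2) / 2 * w s with hDdef
  set φ : Fin 4 → ℝ → ℝ := ![fun s => R - x s, fun s => Λ s - K * ε ^ 2 / 2,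
    fun s => w₁ - w s, fun s => w s - w₂] with hφ
  set Λ' : ℝ → ℝ := fun s => ρ s ^ (m - 2) * (2 * q s * (-K * P s - D s * q s + e s) +
    2 * K * P s * q s + β * (q s * q s + P s * (-K * P s - D s * q s + e s))) with hΛ'
  set w' : ℝ → ℝ := fun s => ρ s ^ (m - 2) * (X s / x s ^ (m - 1) - m / 2 * w s ^ 2) with hw'
  set φ' : Fin 4 → ℝ → ℝ := ![fun s => -vx s, Λ', fun s => -w' s, w'] with hφ'
  have hρpos : ∀ s, R ≤ x s → 0 < ρ s := fun s hs => Real.sqrt_pos.2 (hRpos.trans_le hs)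
  obtain ⟨k, rfl⟩ : ∃ k, m = k + 3 := ⟨m - 3, by omega⟩
  have hn := fun s hs (hxs : R ≤ x s) => hasDerivAt_normalized (k := k) (hd s hs).1 (hd s hs).2.1
    (hd s hs).2.2.1 (hd s hs).2.2.2 (hRpos.trans_le hxs)
  have hwd : ∀ s ∈ Set.Icc 0 δ, R ≤ x s → HasDerivAt w (w' s) s := fun s hs hxs => (hn s hs hxs).1
  have hPd : ∀ s ∈ Set.Icc 0 δ, R ≤ x s → HasDerivAt P (ρ s ^ (k + 1) * q s) s :=
    fun s hs hxs => (hn s hs hxs).2.1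
  have hqd : ∀ s ∈ Set.Icc 0 δ, R ≤ x s →
      HasDerivAt q (ρ s ^ (k + 1) * (-K * P s - D s * q s + e s)) s := by
    intro s hs hxs
    refine (hn s hs hxs).2.2.congr_deriv ?_
    simp only [he, hDdef, hw, hq, hρ]
    ring
  have hΛd : ∀ s ∈ Set.Icc 0 δ, R ≤ x s → HasDerivAt Λ (Λ' s) s := by
    intro s hs hxs
    have h1 := hPd s hs hxs
    have h2 := hqd s hs hxs
    have h3 := ((h2.pow 2).add ((h1.pow 2).const_mul K)).add ((h1.const_mul β).mul h2)
    refine h3.congr_deriv ?_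
    simp only [hΛ', show k + 3 - 2 = k + 1 by omega]
    push_cast
    ring
  have hxI : ∀ s ∈ Set.Icc 0 δ, ContinuousWithinAt x (Set.Icc 0 δ) s :=
    fun s hs => (hd s hs).1.continuousAt.continuousWithinAt
  have hρ00 : ρ 0 = Real.sqrt (2 * R) := by simp only [hρ, hx0]
  have hw0 : w 0 = Real.sqrt (A / ↑(k + 3)) := by
    have : Real.sqrt (2 * R) ≠ 0 := (Real.sqrt_pos.2 (by linarith)).ne'
    simp only [hw, hvx0, hρ00]
    field_simp
  have hneg := forall_neg_of_barrier (0 : Fin 4) (φ := φ) (φ' := φ') (δ := δ) ?_ ?_ ?_ ?_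
  · have hxs : ∀ s ∈ Set.Icc 0 δ, R ≤ x s := fun s hs => (sub_neg.1 (hneg s hs 0)).le
    refine false_of_superlinear_growth (k := k) hw₁0 hδ (fun s hs => (hd s hs).1)
      (fun s hs => hR1.trans (hxs s hs)) (fun s hs => ?_) (by rw [hx0]; linarith)
    have hws : w₁ < w s := sub_neg.1 (hneg s hs 2)
    exact (le_div_iff₀ (pow_pos (hρpos s (hxs s hs)) _)).1 hws.le
  · have hP0 : P 0 = 0 := by simp [hP, hy0]
    have hq0 : q 0 = 0 := by simp [hq, hy0, hvy0]
    have h0 : R - x 0 < 0 := by rw [hx0]; linarith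
    have h1 : Λ 0 - K * ε ^ 2 / 2 < 0 := by
      have : 0 < K * ε ^ 2 := by positivity
      have : Λ 0 = 0 := by simp [hΛ, hP0, hq0]
      linarith
    have h2 : w₁ - w 0 < 0 := by
      rw [hw0]
      refine sub_neg.2 (Real.sqrt_lt_sqrt (by positivity) ?_)
      rw [div_lt_div_iff₀ (by positivity) (by positivity)]
      nlinarith [mul_pos hA hm0]
    have h3 : w 0 - w₂ < 0 := by
      rw [hw0]
      refine sub_neg.2 (Real.sqrt_lt_sqrt (by positivity) ?_)
      rw [div_lt_div_iff₀ (by positivity) (by positivity)]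
      nlinarith [mul_pos hA hm0]
    exact fun i => match i with | 0 => h0 | 1 => h1 | 2 => h2 | 3 => h3
  · exact fun s hs => continuousWithinAt_const.sub (hxI s hs)
  · intro s hs h i
    have hxs : R ≤ x s := sub_nonpos.1 h
    exact match i with
      | 0 => (hd s hs).1.const_sub R
      | 1 => (hΛd s hs hxs).sub_const (K * ε ^ 2 / 2)
      | 2 => (hwd s hs hxs).const_sub w₁
      | 3 => (hwd s hs hxs).sub_const w₂
  · intro s hs h i hi
    have hxs : R ≤ x s := sub_nonpos.1 (h 0)
    have hws : w₁ ≤ w s := sub_nonpos.1 (h 2)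
    have hws₂ : w s ≤ w₂ := sub_nonpos.1 (h 3)
    have hΛs : Λ s ≤ K * ε ^ 2 / 2 := sub_nonpos.1 (h 1)
    have hxpos : 0 < x s := hRpos.trans_le hxs
    have hρ0 := hρpos s hxs
    have hPε : |P s| ≤ ε := by
      apply abs_le_of_sq_le_sq _ hε.le
      have h1 := hcoer (P s) (q s)
      have h2 : K * P s ^ 2 ≤ K * ε ^ 2 := by
        have : 2 * Λ s ≤ K * ε ^ 2 := by linarith
        simp only [hΛ] at this
        nlinarith [sq_nonneg (q s)]
      exact le_of_mul_le_mul_left h2 hK0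
    have hyx : y s = P s * x s := by simp only [hP]; field_simp
    have hyε : |y s| ≤ ε * x s := by
      rw [hyx, abs_mul, abs_of_pos hxpos]; gcongr
    obtain ⟨hX, hT⟩ := hforce s hs hxs hyε
    simp only [show k + 3 - 1 = k + 2 by omega] at hX hT
    have hXl : A / 4 ≤ X s / x s ^ (k + 2) := by
      rw [le_div_iff₀ (by positivity)]; linarith [neg_le_of_abs_le hX]
    have hXu : X s / x s ^ (k + 2) ≤ 3 * A / 4 := by
      rw [div_le_iff₀ (by positivity)]; linarith [le_of_abs_le hX]
    have hθ : 0 < ρ s ^ (k + 1) := by positivity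
    have hvx : vx s = w s * ρ s ^ (k + 3) := by simp only [hw]; field_simp
    exact match i, hi with
      | 0, _ => by
        change -vx s < 0
        have := hw₁0.trans_le hws
        rw [hvx, Left.neg_neg_iff]
        positivity
      | 1, hi => by
        change Λ s - K * ε ^ 2 / 2 = 0 at hi
        refine mul_neg_of_pos_of_neg hθ (hlyap ε hε _ _ _ _ ?_ ?_ ?_ (sub_eq_zero.1 hi))
        · simp only [hDdef]; gcongr
        · simp only [hDdef]; gcongr
        · have h1 : e s = (x s * Y s - y s * X s + ↑(k + 3) * A / 2 * x s ^ (k + 2) * y s) /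
              x s ^ (k + 3) := by
            simp only [he, hP, hK]
            field_simp
            ring
          rw [h1, abs_div, abs_of_pos (pow_pos hxpos (k + 3)), div_le_iff₀ (by positivity)]
          exact hT
      | 2, hi => by
        have hwe : w s = w₁ := (sub_eq_zero.1 hi).symm
        have h2 : ((k + 3 : ℕ) : ℝ) / 2 * w₁ ^ 2 = A / 8 := by rw [hw₁2]; field_simp; norm_num
        refine neg_neg_of_pos (mul_pos hθ ?_)
        rw [hwe, h2, show k + 3 - 1 = k + 2 by omega]; linarith
      | 3, hi => by
        have hwe : w s = w₂ := sub_eq_zero.1 hi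
        have h2 : ((k + 3 : ℕ) : ℝ) / 2 * w₂ ^ 2 = A := by rw [hw₂2]; field_simp
        refine mul_neg_of_pos_of_neg hθ ?_
        rw [hwe, h2, show k + 3 - 1 = k + 2 by omega]; linarith

/-! ### Incompleteness for polynomial gradients -/

theorem norm_one_add_pow_sub_le (n : ℕ) {w : ℂ} (hw : ‖w‖ ≤ 1) :
    ‖(1 + w) ^ n - 1 - n * w‖ ≤ 3 ^ n * ‖w‖ ^ 2 := by
  induction n with
  | zero => simp
  | succ n ih =>
    have h1 : (1 + w) ^ (n + 1) - 1 - ((n + 1 : ℕ) : ℂ) * w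
        = (1 + w) * ((1 + w) ^ n - 1 - n * w) + n * w ^ 2 := by push_cast; ring
    have h2 : ‖1 + w‖ ≤ 2 := (norm_add_le _ _).trans (by rw [norm_one]; linarith)
    have h3 : (n : ℝ) ≤ 3 ^ n := by exact_mod_cast (Nat.lt_pow_self (by norm_num)).le
    rw [h1]
    calc _ ≤ ‖1 + w‖ * ‖(1 + w) ^ n - 1 - n * w‖ + ‖(n : ℂ) * w ^ 2‖ := by
          rw [← norm_mul]; exact norm_add_le _ _
      _ ≤ 2 * (3 ^ n * ‖w‖ ^ 2) + 3 ^ n * ‖w‖ ^ 2 := by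
          rw [norm_mul, norm_pow, Complex.norm_natCast]; gcongr
      _ = 3 ^ (n + 1) * ‖w‖ ^ 2 := by ring

theorem norm_one_add_pow_sub_one_le (n : ℕ) {w : ℂ} (hw : ‖w‖ ≤ 1) :
    ‖(1 + w) ^ n - 1‖ ≤ 2 * 3 ^ n * ‖w‖ := by
  have h3 : (n : ℝ) ≤ 3 ^ n := by exact_mod_cast (Nat.lt_pow_self (by norm_num)).le
  calc ‖(1 + w) ^ n - 1‖ = ‖((1 + w) ^ n - 1 - n * w) + n * w‖ := by congr 1; ring
    _ ≤ 3 ^ n * ‖w‖ ^ 2 + n * ‖w‖ := by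
        refine (norm_add_le _ _).trans (add_le_add (norm_one_add_pow_sub_le n hw) ?_)
        rw [norm_mul, Complex.norm_natCast]
    _ ≤ 3 ^ n * ‖w‖ + 3 ^ n * ‖w‖ := by
        gcongr
        exact pow_le_of_le_one (norm_nonneg _) hw two_ne_zero
    _ = 2 * 3 ^ n * ‖w‖ := by ring

/-- In a thin cone around the positive real axis, a force `½ conj G` with `G` close to `A zⁿ` has
radial component close to `(A / 2) xⁿ` and torque close to the linear restoring torque. -/
theorem radial_force_of_norm_sub_le {n : ℕ} {A ε η x y : ℝ} {G : ℂ} (hA : 0 < A) (hx : 0 < x)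
    (hε : ε ≤ 1) (hy : |y| ≤ ε * x)
    (hG : ‖G - A * (⟨x, y⟩ : ℂ) ^ n‖ ≤ η * x ^ n) :
    |G.re / 2 - A / 2 * x ^ n| ≤ (A * 3 ^ n * ε + η / 2) * x ^ n ∧
    |x * (-G.im / 2) - y * (G.re / 2) + (n + 1 : ℕ) * A / 2 * x ^ n * y| ≤
      (A * 3 ^ (n + 1) * ε ^ 2 / 2 + η) * x ^ (n + 1) := by
  set z : ℂ := ⟨x, y⟩ with hz
  set w : ℂ := ((y / x : ℝ) : ℂ) * Complex.I with hw
  have hzw : z = x * (1 + w) := by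
    apply Complex.ext
    · simp [hz, hw]
    · simp [hz, hw]; field_simp
  have hwn : ‖w‖ ≤ ε := by
    rw [hw, norm_mul, Complex.norm_I, mul_one, Complex.norm_real, Real.norm_eq_abs, abs_div,
      abs_of_pos hx, div_le_iff₀ hx]
    exact hy
  have hw1 := hwn.trans hε
  have hε0 : 0 ≤ ε := (norm_nonneg _).trans hwn
  have hη : 0 ≤ η * x ^ n := (norm_nonneg _).trans hG
  have hzn : ‖z‖ ≤ 2 * x := by
    rw [hzw, norm_mul, Complex.norm_real, Real.norm_eq_abs, abs_of_pos hx, mul_comm]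
    gcongr
    exact (norm_add_le _ _).trans (by rw [norm_one]; linarith)
  constructor
  · have h1 : ‖G - (A * x ^ n : ℝ)‖ ≤ 2 * (A * 3 ^ n * ε + η / 2) * x ^ n := by
      have h2 : G - (A * x ^ n : ℝ) = (G - A * z ^ n) + A * x ^ n * ((1 + w) ^ n - 1) := by
        rw [hzw, mul_pow]; push_cast; ring
      rw [h2]
      refine (norm_add_le _ _).trans ?_
      have h3 : ‖(A * x ^ n * ((1 + w) ^ n - 1) : ℂ)‖ ≤ A * x ^ n * (2 * 3 ^ n * ε) := by
        rw [norm_mul, norm_mul, norm_pow, Complex.norm_real, Complex.norm_real, Real.norm_eq_abs,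
          Real.norm_eq_abs, abs_of_pos hA, abs_of_pos hx]
        gcongr
        exact (norm_one_add_pow_sub_one_le n hw1).trans (by gcongr)
      linarith
    have h4 := (Complex.abs_re_le_norm _).trans h1
    rw [Complex.sub_re, Complex.ofReal_re] at h4
    rw [show G.re / 2 - A / 2 * x ^ n = (G.re - A * x ^ n) / 2 by ring, abs_div,
      abs_of_pos (zero_lt_two (α := ℝ))]
    linarith
  · have h1 : ‖z * G - (A * x ^ (n + 1) : ℝ) * (1 + (n + 1 : ℕ) * w)‖ ≤
        2 * (A * 3 ^ (n + 1) * ε ^ 2 / 2 + η) * x ^ (n + 1) := by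
      have h2 : z * G - (A * x ^ (n + 1) : ℝ) * (1 + (n + 1 : ℕ) * w) =
          z * (G - A * z ^ n) + A * x ^ (n + 1) * ((1 + w) ^ (n + 1) - 1 - (n + 1 : ℕ) * w) := by
        rw [hzw]; simp only [mul_pow]; push_cast; ring
      rw [h2]
      refine (norm_add_le _ _).trans ?_
      have h3 : ‖(A * x ^ (n + 1) * ((1 + w) ^ (n + 1) - 1 - (n + 1 : ℕ) * w) : ℂ)‖ ≤
          A * x ^ (n + 1) * (3 ^ (n + 1) * ε ^ 2) := by
        rw [norm_mul, norm_mul, norm_pow, Complex.norm_real, Complex.norm_real, Real.norm_eq_abs,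
          Real.norm_eq_abs, abs_of_pos hA, abs_of_pos hx]
        gcongr
        exact (norm_one_add_pow_sub_le (n + 1) hw1).trans (by gcongr)
      have h4 : ‖z * (G - A * z ^ n)‖ ≤ 2 * x * (η * x ^ n) := by
        rw [norm_mul]; gcongr
      calc _ ≤ 2 * x * (η * x ^ n) + A * x ^ (n + 1) * (3 ^ (n + 1) * ε ^ 2) := add_le_add h4 h3
        _ = _ := by ring
    have h4 := (Complex.abs_im_le_norm _).trans h1
    have h5 : (z * G - (A * x ^ (n + 1) : ℝ) * (1 + (n + 1 : ℕ) * w)).im =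
        x * G.im + y * G.re - A * x ^ (n + 1) * ((n + 1 : ℕ) * (y / x)) := by
      rw [Complex.sub_im, Complex.mul_im, Complex.im_ofReal_mul]
      simp [hz, hw]
    rw [h5] at h4
    have h6 : x * (-G.im / 2) - y * (G.re / 2) + (n + 1 : ℕ) * A / 2 * x ^ n * y =
        -((x * G.im + y * G.re - A * x ^ (n + 1) * ((n + 1 : ℕ) * (y / x))) / 2) := by
      field_simp
      ring
    rw [h6, abs_neg, abs_div, abs_of_pos (zero_lt_two (α := ℝ))]
    linarith

/-- The motion in the potential `-½ Re F` with `F' = ∑ bₖ(s) zᵏ` polynomial of degree `n ≥ 2` and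
leading coefficient positive at time `0` is incomplete: suitable initial data on the positive real
axis do not allow a solution up to any prescribed time `δ`. -/
theorem exists_initial_data_false_of_pos {n : ℕ} (hn : 2 ≤ n) {b : ℕ → ℝ → ℂ}
    (hb : ∀ k, ContinuousAt (b k) 0) {A : ℝ} (hA : 0 < A) (hbn : b n 0 = A) {δ : ℝ} (hδ : 0 < δ) :
    ∃ z₀ z₁ : ℂ, ∀ z z' : ℝ → ℂ, z 0 = z₀ → z' 0 = z₁ →
      (∀ s ∈ Set.Icc 0 δ, HasDerivAt z (z' s) s ∧
        HasDerivAt z' (1 / 2 * (starRingEnd ℂ) (∑ k ∈ Finset.range (n + 1), b k s * z s ^ k)) s) →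
      False := by
  obtain ⟨c, hc, hmain⟩ := exists_forall_false_of_radial_force (m := n + 1) (by omega) hA
  obtain ⟨ε, hε0, hε1, hε2, hε3⟩ : ∃ ε : ℝ, 0 < ε ∧ ε ≤ 1 ∧ 3 ^ n * ε ≤ 1 / 8 ∧
      A * 3 ^ (n + 1) * ε ≤ c := by
    refine ⟨min 1 (min (1 / 8 / 3 ^ n) (c / (A * 3 ^ (n + 1)))), by positivity, min_le_left _ _,
      ?_, ?_⟩
    · rw [mul_comm, ← le_div_iff₀ (by positivity)]
      exact (min_le_right _ _).trans (min_le_left _ _)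
    · rw [mul_comm, ← le_div_iff₀ (by positivity)]
      exact (min_le_right _ _).trans (min_le_right _ _)
  set η := min (A / 4) (c * ε / 2) with hη
  have hη0 : 0 < η := by positivity
  -- On a short time interval the lower coefficients are bounded and the leading one is near `A`.
  set B : ℝ := ∑ k ∈ Finset.range n, (‖b k 0‖ + 1) with hB
  have hev : ∀ᶠ s in nhds (0 : ℝ), (∀ k ∈ Finset.range n, ‖b k s‖ < ‖b k 0‖ + 1) ∧
      ‖b n s - A‖ < η / 2 / 2 ^ n := by
    refine Filter.Eventually.and ?_ ?_
    · exact (Filter.eventually_all_finset _).2 fun k _ =>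
        (hb k).norm.eventually (gt_mem_nhds (lt_add_one _))
    · have h1 : ContinuousAt (fun s => ‖b n s - A‖) 0 := ((hb n).sub continuousAt_const).norm
      refine h1.eventually (gt_mem_nhds ?_)
      simp only [hbn, sub_self, norm_zero]; positivity
  obtain ⟨r, hr, hball⟩ := Metric.eventually_nhds_iff.1 hev
  set δ' := min δ (r / 2) with hδ'
  have hδ'0 : 0 < δ' := by positivity
  have hsmall : ∀ s ∈ Set.Icc 0 δ', (∀ k ∈ Finset.range n, ‖b k s‖ ≤ ‖b k 0‖ + 1) ∧
      ‖b n s - A‖ ≤ η / 2 / 2 ^ n := by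
    intro s hs
    have h1 : dist s 0 < r := by
      rw [Real.dist_eq, sub_zero, abs_of_nonneg hs.1]
      linarith [hs.2, min_le_right δ (r / 2)]
    exact ⟨fun k hk => ((hball h1).1 k hk).le, (hball h1).2.le⟩
  obtain ⟨R₁, hR₁, hfalse⟩ := hmain ε hε0 δ' hδ'0
  set R := max R₁ (max 1 (B * 2 ^ n * 2 / η)) with hR
  have hR1 : 1 ≤ R := (le_max_left _ _).trans (le_max_right _ _)
  have hRB : B * 2 ^ n ≤ η / 2 * R := by
    have : B * 2 ^ n * 2 / η ≤ R := (le_max_right _ _).trans (le_max_right _ _)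
    rw [div_le_iff₀ hη0] at this
    linarith
  refine ⟨(2 * R : ℝ), (√(A / (n + 1 : ℕ)) * √(2 * R) ^ (n + 1) : ℝ), fun z z' hz0 hz1 hd => ?_⟩
  set G : ℝ → ℂ := fun s => ∑ k ∈ Finset.range (n + 1), b k s * z s ^ k with hG
  refine hfalse R (le_max_left _ _) (fun s => (z s).re) (fun s => (z s).im) (fun s => (z' s).re)
    (fun s => (z' s).im) (fun s => (G s).re / 2) (fun s => -(G s).im / 2) ?_ ?_ ?_ ?_ ?_ ?_
  · intro s hs
    have hs' : s ∈ Set.Icc 0 δ := ⟨hs.1, hs.2.trans (min_le_left _ _)⟩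
    obtain ⟨h1, h2⟩ := hd s hs'
    have hre : ∀ {f : ℝ → ℂ} {f' : ℂ}, HasDerivAt f f' s → HasDerivAt (fun s => (f s).re) f'.re s :=
      fun h => (Complex.reCLM.hasFDerivAt.comp_hasDerivAt s h)
    have him : ∀ {f : ℝ → ℂ} {f' : ℂ}, HasDerivAt f f' s → HasDerivAt (fun s => (f s).im) f'.im s :=
      fun h => (Complex.imCLM.hasFDerivAt.comp_hasDerivAt s h)
    have h2re : (1 / 2 * (starRingEnd ℂ) (G s)).re = (G s).re / 2 := by
      simp [Complex.mul_re]; ring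
    have h2im : (1 / 2 * (starRingEnd ℂ) (G s)).im = -(G s).im / 2 := by
      simp [Complex.mul_im]; ring
    exact ⟨hre h1, him h1, h2re ▸ hre h2, h2im ▸ him h2⟩
  · intro s hs hxs hys
    have hx1 : 1 ≤ (z s).re := hR1.trans hxs
    have hx : 0 < (z s).re := by linarith
    have hzn : ‖z s‖ ≤ 2 * (z s).re := by
      have h1 := Complex.norm_le_abs_re_add_abs_im (z s)
      rw [abs_of_pos hx] at h1
      nlinarith
    obtain ⟨hlow, hlead⟩ := hsmall s hs
    have hGA : ‖G s - A * (⟨(z s).re, (z s).im⟩ : ℂ) ^ n‖ ≤ η * (z s).re ^ n := by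
      have h1 : G s - A * (⟨(z s).re, (z s).im⟩ : ℂ) ^ n =
          (∑ k ∈ Finset.range n, b k s * z s ^ k) + (b n s - A) * z s ^ n := by
        simp only [hG, Finset.sum_range_succ, Complex.eta]; ring
      rw [h1]
      have h2 : ‖∑ k ∈ Finset.range n, b k s * z s ^ k‖ ≤ η / 2 * (z s).re ^ n := by
        calc _ ≤ ∑ k ∈ Finset.range n, (‖b k 0‖ + 1) * (2 ^ n * (z s).re ^ (n - 1)) := by
              refine norm_sum_le_of_le _ fun k hk => ?_
              rw [norm_mul, norm_pow]
              have hk' : k < n := Finset.mem_range.1 hk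
              refine mul_le_mul (hlow k hk) ?_ (by positivity) (by positivity)
              calc ‖z s‖ ^ k ≤ (2 * (z s).re) ^ k := by gcongr
                _ = 2 ^ k * (z s).re ^ k := mul_pow _ _ _
                _ ≤ 2 ^ n * (z s).re ^ (n - 1) := by
                  gcongr
                  · norm_num
                  · omega
          _ = B * 2 ^ n * (z s).re ^ (n - 1) := by rw [← Finset.sum_mul, ← hB]; ring
          _ ≤ η / 2 * R * (z s).re ^ (n - 1) := by gcongr
          _ ≤ η / 2 * (z s).re * (z s).re ^ (n - 1) := by gcongr
          _ = η / 2 * (z s).re ^ n := by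
              obtain ⟨j, rfl⟩ : ∃ j, n = j + 1 := ⟨n - 1, by omega⟩
              rw [Nat.add_sub_cancel]; ring
      have h3 : ‖(b n s - A) * z s ^ n‖ ≤ η / 2 * (z s).re ^ n := by
        rw [norm_mul, norm_pow]
        calc _ ≤ η / 2 / 2 ^ n * (2 * (z s).re) ^ n := by gcongr
          _ = _ := by rw [mul_pow]; field_simp
      exact (norm_add_le _ _).trans (by linarith)
    obtain ⟨h1, h2⟩ := radial_force_of_norm_sub_le hA hx hε1 hys hGA
    rw [Nat.add_sub_cancel]
    refine ⟨h1.trans ?_, h2.trans ?_⟩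
    · gcongr
      have : η ≤ A / 4 := min_le_left _ _
      nlinarith
    · gcongr
      have : η ≤ c * ε / 2 := min_le_right _ _
      nlinarith
  · simp [hz0]
  · simp [hz0]
  · simp only [hz1, Complex.ofReal_re]
  · simp only [hz1, Complex.ofReal_im]

/-- As `exists_initial_data_false_of_pos`, for an arbitrary nonzero leading coefficient: a rotation
of the plane makes it positive. -/
theorem exists_initial_data_false {n : ℕ} (hn : 2 ≤ n) {b : ℕ → ℝ → ℂ}
    (hb : ∀ k, ContinuousAt (b k) 0) (hbn : b n 0 ≠ 0) {δ : ℝ} (hδ : 0 < δ) :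
    ∃ z₀ z₁ : ℂ, ∀ z z' : ℝ → ℂ, z 0 = z₀ → z' 0 = z₁ →
      (∀ s ∈ Set.Icc 0 δ, HasDerivAt z (z' s) s ∧
        HasDerivAt z' (1 / 2 * (starRingEnd ℂ) (∑ k ∈ Finset.range (n + 1), b k s * z s ^ k)) s) →
      False := by
  obtain ⟨ζ, hζ⟩ : ∃ ζ : ℂ, ζ ^ (n + 1) = (starRingEnd ℂ) (b n 0) / ‖b n 0‖ :=
    IsAlgClosed.exists_pow_nat_eq _ (by omega)
  have hbn' : (‖b n 0‖ : ℂ) ≠ 0 := by simpa using hbn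
  have hζ1 : ‖ζ‖ = 1 := by
    have h1 : ‖ζ‖ ^ (n + 1) = 1 := by
      rw [← norm_pow, hζ, norm_div, RCLike.norm_conj, Complex.norm_real, norm_norm,
        div_self (norm_ne_zero_iff.2 hbn)]
    exact (pow_eq_one_iff_of_nonneg (norm_nonneg _) (by omega)).1 h1
  have hζζ : (starRingEnd ℂ) ζ * ζ = 1 := by
    rw [mul_comm, Complex.mul_conj, Complex.normSq_eq_norm_sq, hζ1]; simp
  obtain ⟨z₀, z₁, h⟩ := exists_initial_data_false_of_pos hn (b := fun k s => ζ ^ (k + 1) * b k s)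
    (fun k => continuousAt_const.mul (hb k)) (norm_pos_iff.2 hbn) (by
      simp only [hζ]
      rw [div_mul_eq_mul_div, mul_comm, Complex.mul_conj, Complex.normSq_eq_norm_sq]
      push_cast
      field_simp) hδ
  refine ⟨ζ * z₀, ζ * z₁, fun z z' hz0 hz1 hd => h (fun s => (starRingEnd ℂ) ζ * z s)
    (fun s => (starRingEnd ℂ) ζ * z' s) ?_ ?_ fun s hs => ⟨(hd s hs).1.const_mul _, ?_⟩⟩
  · simp only [hz0]; rw [← mul_assoc, hζζ, one_mul]
  · simp only [hz1]; rw [← mul_assoc, hζζ, one_mul]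
  · refine ((hd s hs).2.const_mul ((starRingEnd ℂ) ζ)).congr_deriv ?_
    rw [mul_left_comm, ← map_mul, Finset.mul_sum]
    congr 2
    refine Finset.sum_congr rfl fun k _ => ?_
    have h1 : ζ ^ (k + 1) * (starRingEnd ℂ) ζ ^ k = ζ := by
      rw [pow_succ, mul_right_comm, ← mul_pow, mul_comm ζ, hζζ, one_pow, one_mul]
    rw [mul_pow]
    linear_combination (-(b k s * z s ^ k)) * h1

/-! ### Global solutions of Lipschitz differential equations -/

/-- The radial retraction of a normed space onto the closed ball of radius `R`. -/
noncomputable def radialRetraction {E : Type*} [NormedAddCommGroup E] [NormedSpace ℝ E] (R : ℝ)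
    (x : E) : E :=
  (R / max R ‖x‖) • x

section RadialRetraction

variable {E : Type*} [NormedAddCommGroup E] [NormedSpace ℝ E] {R : ℝ}

theorem radialRetraction_eq_self (hR : 0 < R) {x : E} (hx : ‖x‖ ≤ R) :
    radialRetraction R x = x := by
  rw [radialRetraction, max_eq_left hx, div_self hR.ne', one_smul]

theorem norm_radialRetraction_le (hR : 0 < R) (x : E) : ‖radialRetraction R x‖ ≤ R := by
  have h : 0 < max R ‖x‖ := lt_max_of_lt_left hR
  rw [radialRetraction, norm_smul, Real.norm_eq_abs, abs_of_pos (by positivity),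
    div_mul_eq_mul_div, div_le_iff₀ h]
  gcongr
  exact le_max_right _ _

theorem norm_radialRetraction_le_norm (hR : 0 < R) (x : E) : ‖radialRetraction R x‖ ≤ ‖x‖ := by
  have h : 0 < max R ‖x‖ := lt_max_of_lt_left hR
  rw [radialRetraction, norm_smul, Real.norm_eq_abs, abs_of_pos (by positivity)]
  exact mul_le_of_le_one_left (norm_nonneg _) ((div_le_one h).2 (le_max_left _ _))

theorem lipschitzWith_radialRetraction (hR : 0 < R) :
    LipschitzWith 2 (radialRetraction R : E → E) := by
  refine LipschitzWith.of_dist_le_mul fun x y => ?_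
  rw [dist_eq_norm, dist_eq_norm]
  set a := max R ‖x‖ with ha
  set b := max R ‖y‖ with hb
  have ha0 : 0 < a := lt_max_of_lt_left hR
  have hb0 : 0 < b := lt_max_of_lt_left hR
  have h1 : radialRetraction R x - radialRetraction R y =
      (R / a) • (x - y) + (R / a * ((b - a) / b)) • y := by
    simp only [radialRetraction, ← ha, ← hb]
    have : R / b = R / a - R / a * ((b - a) / b) := by field_simp; ring
    rw [this]
    module
  have hRa : R / a ≤ 1 := (div_le_one ha0).2 (le_max_left _ _)
  have hab : |b - a| ≤ ‖x - y‖ := by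
    refine (abs_max_sub_max_le_max _ _ _ _).trans ?_
    rw [sub_self, abs_zero, max_eq_right (abs_nonneg _), norm_sub_rev]
    exact abs_norm_sub_norm_le _ _
  have h2 : ‖(R / a) • (x - y)‖ ≤ ‖x - y‖ := by
    rw [norm_smul, Real.norm_eq_abs, abs_of_pos (by positivity)]
    exact mul_le_of_le_one_left (norm_nonneg _) hRa
  have h3 : ‖(R / a * ((b - a) / b)) • y‖ ≤ ‖x - y‖ := by
    rw [norm_smul, Real.norm_eq_abs, abs_mul, abs_of_pos (show 0 < R / a by positivity),
      abs_div, abs_of_pos hb0]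
    have h4 : ‖y‖ / b ≤ 1 := (div_le_one hb0).2 (le_max_right _ _)
    calc R / a * (|b - a| / b) * ‖y‖ = (R / a) * (|b - a| * (‖y‖ / b)) := by ring
      _ ≤ 1 * (|b - a| * 1) := by gcongr
      _ ≤ ‖x - y‖ := by simpa using hab
  rw [h1]
  calc _ ≤ ‖x - y‖ + ‖x - y‖ := (norm_add_le _ _).trans (add_le_add h2 h3)
    _ = ((2 : NNReal) : ℝ) * ‖x - y‖ := by rw [NNReal.coe_ofNat]; ring

end RadialRetraction

section GlobalODE

open Set

variable {E : Type*} [NormedAddCommGroup E] [NormedSpace ℝ E] {f : ℝ → E → E} {t₀ : ℝ}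

/-- A Grönwall bound on both sides of the initial time. -/
theorem norm_le_gronwallBound_of_mem_Ioo {α α' : ℝ → E} {T K C : ℝ} (hK : 0 ≤ K) (hC : 0 ≤ C)
    (hd : ∀ t ∈ Ioo (t₀ - T) (t₀ + T), HasDerivAt α (α' t) t)
    (hb : ∀ t ∈ Ioo (t₀ - T) (t₀ + T), ‖α' t‖ ≤ K * ‖α t‖ + C) :
    ∀ t ∈ Ioo (t₀ - T) (t₀ + T), ‖α t‖ ≤ gronwallBound ‖α t₀‖ K C T := by
  -- It suffices to argue forwards in time: the reflected curve covers the past.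
  have key : ∀ β β' : ℝ → E, (∀ t ∈ Ioo (t₀ - T) (t₀ + T), HasDerivAt β (β' t) t) →
      (∀ t ∈ Ioo (t₀ - T) (t₀ + T), ‖β' t‖ ≤ K * ‖β t‖ + C) →
      ∀ t ∈ Ico t₀ (t₀ + T), ‖β t‖ ≤ gronwallBound ‖β t₀‖ K C T := by
    intro β β' hβ hβb t ht
    have hmem : ∀ s ∈ Icc t₀ t, s ∈ Ioo (t₀ - T) (t₀ + T) := fun s hs =>
      ⟨by linarith [hs.1, ht.1, ht.2], hs.2.trans_lt ht.2⟩
    refine (norm_le_gronwallBound_of_norm_deriv_right_le (f' := β')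
      (fun s hs => (hβ s (hmem s hs)).continuousAt.continuousWithinAt)
      (fun s hs => (hβ s (hmem s (Ico_subset_Icc_self hs))).hasDerivWithinAt) le_rfl
      (fun s hs => hβb s (hmem s (Ico_subset_Icc_self hs))) t (right_mem_Icc.2 ht.1)).trans ?_
    exact gronwallBound_mono (norm_nonneg _) hC hK (by linarith [ht.2])
  intro t ht
  rcases le_total t₀ t with h | h
  · exact key α α' hd hb t ⟨h, ht.2⟩
  · have hmem : ∀ s ∈ Ioo (t₀ - T) (t₀ + T), 2 * t₀ - s ∈ Ioo (t₀ - T) (t₀ + T) := fun s hs =>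
      ⟨by linarith [hs.2], by linarith [hs.1]⟩
    have h1 := key (fun s => α (2 * t₀ - s)) (fun s => -α' (2 * t₀ - s))
      (fun s hs => (hd _ (hmem s hs)).comp_const_sub (2 * t₀) s)
      (fun s hs => by rw [norm_neg]; exact hb _ (hmem s hs)) (2 * t₀ - t)
      ⟨by linarith, by linarith [ht.1]⟩
    simpa [two_mul] using h1

variable [CompleteSpace E]

/-- Existence on a symmetric interval for an ODE with globally Lipschitz right-hand side: the
right-hand side, made bounded by a radial retraction, satisfies the hypotheses of Picard-Lindelöf on
the whole interval, and by Grönwall's inequality the solution does not notice the retraction. -/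
theorem exists_solution_Ioo_of_lipschitzWith (hc : ∀ x, Continuous fun t => f t x) {T : ℝ}
    (hT : 0 < T) {K : NNReal} (hL : ∀ t ∈ Icc (t₀ - T) (t₀ + T), LipschitzWith K (f t)) (x₀ : E) :
    ∃ α : ℝ → E, α t₀ = x₀ ∧ ∀ t ∈ Ioo (t₀ - T) (t₀ + T), HasDerivAt α (f t (α t)) t := by
  obtain ⟨C, hC⟩ := (isCompact_Icc (a := t₀ - T) (b := t₀ + T)).exists_bound_of_continuousOn
    (hc 0).continuousOn
  have hC0 : 0 ≤ C := (norm_nonneg _).trans (hC t₀ ⟨by linarith, by linarith⟩)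
  have hlin : ∀ t ∈ Icc (t₀ - T) (t₀ + T), ∀ x, ‖f t x‖ ≤ K * ‖x‖ + C := by
    intro t ht x
    have h1 := (hL t ht).dist_le_mul x 0
    rw [dist_eq_norm, dist_zero_right] at h1
    calc ‖f t x‖ = ‖(f t x - f t 0) + f t 0‖ := by rw [sub_add_cancel]
      _ ≤ K * ‖x‖ + C := (norm_add_le _ _).trans (add_le_add h1 (hC t ht))
  set R := |gronwallBound ‖x₀‖ K C T| + 1 with hR
  have hR0 : 0 < R := by positivity
  set L : NNReal := ⟨K * R + C, by positivity⟩ with hLdef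
  have hpl : IsPicardLindelof (fun t x => f t (radialRetraction R x)) (tmin := t₀ - T)
      (tmax := t₀ + T) ⟨t₀, by constructor <;> linarith⟩ x₀ (L * ⟨T, hT.le⟩) 0 L (K * 2) :=
    { lipschitzOnWith := fun t ht =>
        ((hL t ht).comp (lipschitzWith_radialRetraction hR0)).lipschitzOnWith
      continuousOn := fun x _ => (hc _).continuousOn
      norm_le := fun t ht x _ => (hlin t ht _).trans (by
        change _ ≤ K * R + C
        gcongr
        exact norm_radialRetraction_le hR0 x)
      mul_max_le := by
        rw [NNReal.coe_zero, sub_zero]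
        change (L : ℝ) * max (t₀ + T - t₀) (t₀ - (t₀ - T)) ≤ L * T
        simp }
  obtain ⟨α, hα0, hα⟩ := hpl.exists_eq_forall_mem_Icc_hasDerivWithinAt₀
  have hd : ∀ t ∈ Ioo (t₀ - T) (t₀ + T), HasDerivAt α (f t (radialRetraction R (α t))) t :=
    fun t ht => (hα t (Ioo_subset_Icc_self ht)).hasDerivAt (Icc_mem_nhds ht.1 ht.2)
  refine ⟨α, hα0, fun t ht => ?_⟩
  have hbound := norm_le_gronwallBound_of_mem_Ioo K.2 hC0 hd (fun s hs =>
    (hlin s (Ioo_subset_Icc_self hs) _).trans 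
      (add_le_add (mul_le_mul_of_nonneg_left (norm_radialRetraction_le_norm hR0 _) K.2) le_rfl)) t ht
  have hRt : ‖α t‖ ≤ R := by
    rw [hα0] at hbound
    exact hbound.trans ((le_abs_self _).trans (lt_add_one _).le)
  simpa only [radialRetraction_eq_self hR0 hRt] using hd t ht

/-- An ODE whose right-hand side is continuous in time and globally Lipschitz in space, locally
uniformly in time, has solutions on the whole real line. -/
theorem exists_solution_of_lipschitzWith (hc : ∀ x, Continuous fun t => f t x)
    (hL : ∀ T : ℝ, ∃ K : NNReal, ∀ t ∈ Icc (t₀ - T) (t₀ + T), LipschitzWith K (f t)) (x₀ : E) :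
    ∃ α : ℝ → E, α t₀ = x₀ ∧ ∀ t, HasDerivAt α (f t (α t)) t := by
  have hex : ∀ n : ℕ, ∃ α : ℝ → E, α t₀ = x₀ ∧
      ∀ t ∈ Ioo (t₀ - (n + 1)) (t₀ + (n + 1)), HasDerivAt α (f t (α t)) t := fun n => by
    obtain ⟨K, hK⟩ := hL (n + 1)
    exact exists_solution_Ioo_of_lipschitzWith hc (by positivity) hK x₀
  choose α hα0 hα using hex
  have huniq : ∀ n N : ℕ, n ≤ N → ∀ t ∈ Ioo (t₀ - (n + 1 : ℝ)) (t₀ + (n + 1)),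
      α n t = α N t := by
    intro n N hnN
    obtain ⟨K, hK⟩ := hL (n + 1)
    have hnN' : (n : ℝ) ≤ N := by exact_mod_cast hnN
    refine ODE_solution_unique_of_mem_Ioo (v := f) (s := fun _ => univ) (K := K) (t₀ := t₀)
      (fun t ht => (hK t (Ioo_subset_Icc_self ht)).lipschitzOnWith)
      ⟨by linarith, by linarith⟩ (fun t ht => ⟨hα n t ht, trivial⟩)
      (fun t ht => ⟨hα N t ⟨by linarith [ht.1], by linarith [ht.2]⟩, trivial⟩) ?_
    rw [hα0, hα0]
  refine ⟨fun t => α ⌈|t - t₀|⌉₊ t, by simp [hα0], fun t => ?_⟩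
  have hin : ∀ s : ℝ, s ∈ Ioo (t₀ - (⌈|s - t₀|⌉₊ + 1 : ℝ)) (t₀ + (⌈|s - t₀|⌉₊ + 1)) := by
    intro s
    have h1 := Nat.le_ceil |s - t₀|
    have h2 := abs_le.1 h1
    exact ⟨by linarith, by linarith⟩
  set N := ⌈|t - t₀|⌉₊ + 1 with hN
  have hev : (fun s => α ⌈|s - t₀|⌉₊ s) =ᶠ[nhds t] α N := by
    filter_upwards [Metric.ball_mem_nhds t one_pos] with s hs
    refine huniq _ N ?_ s (hin s)
    rw [Nat.ceil_le, hN]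
    push_cast
    have h1 : |s - t₀| ≤ |s - t| + |t - t₀| := abs_sub_le _ _ _
    have h2 : |s - t| < 1 := by simpa [Real.dist_eq] using hs
    linarith [Nat.le_ceil |t - t₀|]
  have hd : HasDerivAt (α N) (f t (α N t)) t := by
    have h1 := hin t
    refine hα N t ⟨?_, ?_⟩ <;> rw [hN] <;> push_cast <;> linarith [h1.1, h1.2]
  have := hd.congr_of_eventuallyEq hev
  rwa [← hev.eq_of_nhds] at this

end GlobalODE

/-! ### Entire functions and harmonic functions of polynomial growth -/

/-- A polynomial of total degree `d` grows at most like `‖z‖ ^ d`. -/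
theorem MvPolynomial.exists_abs_eval_le {σ : Type*} [Fintype σ] (q : MvPolynomial σ ℝ) :
    ∃ C, 0 ≤ C ∧ ∀ z : σ → ℝ, |MvPolynomial.eval z q| ≤ C * (1 + ‖z‖) ^ q.totalDegree := by
  refine ⟨∑ d ∈ q.support, |q.coeff d|, Finset.sum_nonneg fun _ _ => abs_nonneg _, fun z => ?_⟩
  rw [MvPolynomial.eval_eq', Finset.sum_mul]
  refine (Finset.abs_sum_le_sum_abs _ _).trans (Finset.sum_le_sum fun d hd => ?_)
  rw [abs_mul, Finset.abs_prod]
  gcongr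
  have h1 : (1 : ℝ) ≤ 1 + ‖z‖ := by linarith [norm_nonneg z]
  calc ∏ i, |z i ^ d i| ≤ ∏ i, (1 + ‖z‖) ^ d i := by
        refine Finset.prod_le_prod (fun _ _ => abs_nonneg _) fun i _ => ?_
        rw [abs_pow]
        gcongr
        linarith [norm_le_pi_norm z i, Real.norm_eq_abs (z i)]
    _ = (1 + ‖z‖) ^ (∑ i, d i) := Finset.prod_pow_eq_pow_sum _ _ _
    _ ≤ (1 + ‖z‖) ^ q.totalDegree := by
        refine pow_le_pow_right₀ h1 ?_
        have := MvPolynomial.le_totalDegree hd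
        rwa [Finsupp.sum_fintype _ _ (fun _ => rfl)] at this

/-- The Taylor coefficients of order greater than `N` of an entire function vanish if its real part
is bounded above by a multiple of `(1 + |z|) ^ N`: by the Borel-Carathéodory inequality the modulus
has the same growth, and Cauchy's estimates apply. -/
theorem iteratedDeriv_eq_zero_of_re_le {F : ℂ → ℂ} (hF : Differentiable ℂ F) {C : ℝ} {N : ℕ}
    (hC : ∀ z, (F z).re ≤ C * (1 + ‖z‖) ^ N) {n : ℕ} (hn : N < n) : iteratedDeriv n F 0 = 0 := by
  set D : ℝ := 2 * (|C| * 3 ^ N + 1) + 3 * ‖F 0‖ with hD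
  have hD0 : 0 < D := by positivity
  have hbound : ∀ R : ℝ, 1 ≤ R → ‖iteratedDeriv n F 0‖ ≤ n.factorial * D / R := by
    intro R hR
    have hR0 : 0 < R := by linarith
    have hRN : 1 ≤ R ^ N := one_le_pow₀ hR
    have hsphere : ∀ z ∈ Metric.sphere (0 : ℂ) R, ‖F z‖ ≤ D * R ^ N := by
      intro z hz
      have hzR : ‖z‖ = R := by simpa using hz
      have h1 := Complex.borelCaratheodory (f := F) (M := |C| * (3 * R) ^ N + 1) (R := 2 * R)
        (z := z) (by positivity) hF.differentiableOn (fun w hw => by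
          have hw' : ‖w‖ < 2 * R := by simpa using hw
          change (F w).re ≤ _
          calc (F w).re ≤ C * (1 + ‖w‖) ^ N := hC w
            _ ≤ |C| * (3 * R) ^ N := by
                gcongr
                · exact le_abs_self C
                · linarith
            _ ≤ _ := by linarith) (by positivity) (by simp [hzR]; linarith)
      rw [hzR, show 2 * R - R = R by ring] at h1
      have h2 : 2 * (|C| * (3 * R) ^ N + 1) * R / R + ‖F 0‖ * (2 * R + R) / R =
          2 * (|C| * 3 ^ N * R ^ N + 1) + 3 * ‖F 0‖ := by
        rw [mul_pow]; field_simp; ring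
      rw [h2] at h1
      refine h1.trans ?_
      rw [hD]
      have h3 : 0 ≤ ‖F 0‖ := norm_nonneg _
      nlinarith
    have h4 := Complex.norm_iteratedDeriv_le_of_forall_mem_sphere_norm_le n hR0
      hF.diffContOnCl hsphere
    refine h4.trans ?_
    rw [div_le_div_iff₀ (by positivity) hR0]
    have h5 : R ^ (N + 1) ≤ R ^ n := pow_le_pow_right₀ hR hn
    calc (n.factorial : ℝ) * (D * R ^ N) * R = n.factorial * D * R ^ (N + 1) := by ring
      _ ≤ n.factorial * D * R ^ n := by gcongr
  have hlim : Filter.Tendsto (fun R : ℝ => n.factorial * D / R) Filter.atTop (nhds 0) :=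
    tendsto_const_nhds.div_atTop Filter.tendsto_id
  have := ge_of_tendsto hlim (Filter.eventually_atTop.2 ⟨1, hbound⟩)
  exact norm_le_zero_iff.1 this

open InnerProductSpace in
/-- An entire harmonic function is the real part of an entire function, whose derivative is the
gradient written as a holomorphic function. -/
theorem exists_re_eq_and_deriv_eq_of_harmonic {h : ℂ → ℝ} (hh : HarmonicOnNhd h Set.univ) :
    ∃ F : ℂ → ℂ, Differentiable ℂ F ∧ (∀ z, (F z).re = h z) ∧
      deriv F = fun z => (fderiv ℝ h z 1 : ℂ) - Complex.I * fderiv ℝ h z Complex.I := by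
  obtain ⟨F, hFa, hFre⟩ := hh.exists_analyticOnNhd_univ_re_eq
  have hF : Differentiable ℂ F := fun z => (hFa z trivial).differentiableAt
  refine ⟨F, hF, fun z => congr_fun hFre z, ?_⟩
  ext z
  have h1 : HasFDerivAt h (Complex.reCLM.comp ((fderiv ℂ F z).restrictScalars ℝ)) z := by
    rw [← hFre]
    exact Complex.reCLM.hasFDerivAt.comp z ((hF z).hasFDerivAt.restrictScalars ℝ)
  have h2 : fderiv ℂ F z Complex.I = Complex.I * deriv F z := by
    rw [fderiv_eq_smul_deriv, smul_eq_mul]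
  rw [h1.fderiv]
  apply Complex.ext
  · simp [h2]
  · simp [h2]

theorem eq_sum_of_iteratedDeriv_eq_zero {g : ℂ → ℂ} (hg : Differentiable ℂ g) {N : ℕ}
    (h : ∀ n, N ≤ n → iteratedDeriv n g 0 = 0) (z : ℂ) :
    g z = ∑ k ∈ Finset.range N, ((k.factorial : ℂ)⁻¹ * iteratedDeriv k g 0) * z ^ k := by
  rw [← Complex.taylorSeries_eq_of_entire' 0 z hg, sub_zero]
  refine tsum_eq_sum fun k hk => ?_
  rw [h k (by simpa using hk), mul_zero, zero_mul]

/-- The Taylor coefficients of a family of entire functions that is jointly continuous depend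
continuously on the parameter, by Cauchy's formula. -/
theorem continuous_iteratedDeriv_of_differentiable {G : ℂ → ℝ → ℂ}
    (hG : Continuous (Function.uncurry G)) (hd : ∀ u, Differentiable ℂ fun z => G z u) (k : ℕ) :
    Continuous fun u => iteratedDeriv k (fun z => G z u) 0 := by
  have h2 : (2 * Real.pi * Complex.I / k.factorial : ℂ) ≠ 0 := by simp [Nat.factorial_ne_zero]
  have h1 : (fun u => iteratedDeriv k (fun z => G z u) 0) = fun u =>
      (2 * Real.pi * Complex.I / k.factorial : ℂ)⁻¹ •
        ∮ z in C((0 : ℂ), 1), (1 / (z - 0) ^ (k + 1)) • G z u := by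
    ext u
    rw [DiffContOnCl.circleIntegral_one_div_sub_center_pow_smul one_pos k (hd u).diffContOnCl,
      inv_smul_smul₀ h2]
  rw [h1]
  suffices h : Continuous fun u => ∮ z in C((0 : ℂ), 1), (1 / (z - 0) ^ (k + 1)) • G z u from
    h.fun_const_smul _
  simp only [circleIntegral]
  refine intervalIntegral.continuous_parametric_intervalIntegral_of_continuous' ?_ 0 (2 * Real.pi)
  have hne : ∀ θ : ℝ, (circleMap 0 1 θ - 0) ^ (k + 1) ≠ 0 := fun θ =>
    pow_ne_zero _ (by rw [sub_zero]; exact circleMap_ne_center one_ne_zero)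
  simp only [Function.uncurry_def, deriv_circleMap]
  have h3 : Continuous fun p : ℝ × ℝ => circleMap (0 : ℂ) 1 p.2 :=
    (continuous_circleMap 0 1).comp continuous_snd
  refine (h3.mul continuous_const).fun_smul (Continuous.fun_smul ?_ ?_)
  · exact continuous_const.div ((h3.sub continuous_const).pow _) fun p => hne p.2
  · exact hG.comp (h3.prodMk continuous_fst)

/-! ### Curvature and geodesics of pp-waves -/

/-- The coefficient `H` of the pp-wave as a function of the four coordinates. -/
def ppCoeff (H : (Fin 2 → ℝ) × ℝ → ℝ) (q : Fin 4 → ℝ) : ℝ := H (![q 0, q 1], q 2)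

theorem partialDeriv_const {n : ℕ} (i : Fin n) (c : ℝ) (p : Fin n → ℝ) :
    partialDeriv i (fun _ => c) p = 0 := by simp [partialDeriv]

theorem contDiff_ppCoeff {H : (Fin 2 → ℝ) × ℝ → ℝ} (hH : ContDiff ℝ ∞ H) :
    ContDiff ℝ ∞ (ppCoeff H) := by
  refine hH.comp (ContDiff.prodMk (contDiff_pi.2 fun i => ?_) (contDiff_apply ℝ ℝ 2))
  fin_cases i
  · exact contDiff_apply ℝ ℝ 0
  · exact contDiff_apply ℝ ℝ 1

theorem contDiff_partialDeriv {n : ℕ} {f : (Fin n → ℝ) → ℝ} (hf : ContDiff ℝ ∞ f) (i : Fin n) :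
    ContDiff ℝ ∞ (partialDeriv i f) :=
  (hf.fderiv_right (m := ∞) (by norm_cast)).clm_apply contDiff_const

section PPWave

variable {H : (Fin 2 → ℝ) × ℝ → ℝ}

theorem partialDeriv_eq_zero_of_forall_add {n : ℕ} {i : Fin n} {f : (Fin n → ℝ) → ℝ}
    (hf : Differentiable ℝ f) (h : ∀ p (t : ℝ), f (p + t • Pi.single i 1) = f p) (p : Fin n → ℝ) :
    partialDeriv i f p = 0 := by
  rw [partialDeriv, ← (hf p).lineDeriv_eq_fderiv]
  simp [lineDeriv, h]

theorem ppCoeff_add_smul_single_three (p : Fin 4 → ℝ) (t : ℝ) :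
    ppCoeff H (p + t • Pi.single 3 1) = ppCoeff H p := by simp [ppCoeff]

theorem partialDeriv_three_ppCoeff (hH : ContDiff ℝ ∞ H) (p : Fin 4 → ℝ) :
    partialDeriv 3 (ppCoeff H) p = 0 :=
  partialDeriv_eq_zero_of_forall_add ((contDiff_ppCoeff hH).differentiable (by simp))
    ppCoeff_add_smul_single_three p

theorem partialDeriv_three_const_mul_partialDeriv_ppCoeff (hH : ContDiff ℝ ∞ H) (c : ℝ)
    (i : Fin 4) (p : Fin 4 → ℝ) :
    partialDeriv 3 (fun p => c * partialDeriv i (ppCoeff H) p) p = 0 := by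
  refine partialDeriv_eq_zero_of_forall_add (((contDiff_partialDeriv (contDiff_ppCoeff hH)
    i).differentiable (by simp)).const_mul c) (fun p t => ?_) p
  rw [partialDeriv, ← fderiv_comp_add_right]
  simp only [ppCoeff_add_smul_single_three]
  rfl

theorem inv_ppWaveMetric (p : Fin 4 → ℝ) : (ppWaveMetric H p)⁻¹ =
    !![1, 0, 0, 0; 0, 1, 0, 0; 0, 0, 0, 1; 0, 0, 1, -ppCoeff H p] := by
  refine Matrix.inv_eq_right_inv ?_
  ext i j
  fin_cases i <;> fin_cases j <;>
    simp [ppWaveMetric, ppCoeff, Matrix.mul_apply, Fin.sum_univ_four]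

theorem partialDeriv_ppWaveMetric (i a b : Fin 4) (p : Fin 4 → ℝ) :
    partialDeriv i (fun q => ppWaveMetric H q a b) p =
      if a = 2 ∧ b = 2 then partialDeriv i (ppCoeff H) p else 0 := by
  fin_cases a <;> fin_cases b <;> first
    | exact partialDeriv_const i _ p
    | rfl

theorem christoffel_ppWaveMetric_zero (i j : Fin 4) (p : Fin 4 → ℝ) :
    christoffel (ppWaveMetric H) 0 i j p =
      if i = 2 ∧ j = 2 then -(1 / 2) * partialDeriv 0 (ppCoeff H) p else 0 := by
  simp only [christoffel, inv_ppWaveMetric, partialDeriv_ppWaveMetric, Fin.sum_univ_four]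
  simp
  split_ifs <;> simp

theorem christoffel_ppWaveMetric_one (i j : Fin 4) (p : Fin 4 → ℝ) :
    christoffel (ppWaveMetric H) 1 i j p =
      if i = 2 ∧ j = 2 then -(1 / 2) * partialDeriv 1 (ppCoeff H) p else 0 := by
  simp only [christoffel, inv_ppWaveMetric, partialDeriv_ppWaveMetric, Fin.sum_univ_four]
  simp
  split_ifs <;> simp

theorem christoffel_ppWaveMetric_two (hH : ContDiff ℝ ∞ H) (i j : Fin 4) (p : Fin 4 → ℝ) :
    christoffel (ppWaveMetric H) 2 i j p = 0 := by
  simp only [christoffel, inv_ppWaveMetric, partialDeriv_ppWaveMetric, Fin.sum_univ_four,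
    partialDeriv_three_ppCoeff hH]
  simp

theorem christoffel_ppWaveMetric_three (hH : ContDiff ℝ ∞ H) (i j : Fin 4) (p : Fin 4 → ℝ) :
    christoffel (ppWaveMetric H) 3 i j p =
      1 / 2 * ((if j = 2 then partialDeriv i (ppCoeff H) p else 0) +
        (if i = 2 then partialDeriv j (ppCoeff H) p else 0) -
        if i = 2 ∧ j = 2 then partialDeriv 2 (ppCoeff H) p else 0) := by
  simp only [christoffel, inv_ppWaveMetric, partialDeriv_ppWaveMetric, Fin.sum_univ_four,
    partialDeriv_three_ppCoeff hH]
  simp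

/-- The only component of the Ricci tensor of a pp-wave that need not vanish is `R_uu`, which is
`-½` times the Laplacian of `H(·, u)`. -/
theorem ricci_ppWaveMetric_two_two (hH : ContDiff ℝ ∞ H) (p : Fin 4 → ℝ) :
    ricci (ppWaveMetric H) 2 2 p = -(1 / 2) *
      (partialDeriv 0 (partialDeriv 0 (ppCoeff H)) p +
        partialDeriv 1 (partialDeriv 1 (ppCoeff H)) p) := by
  have h0 : christoffel (ppWaveMetric H) 0 = fun i j p =>
      if i = 2 ∧ j = 2 then -(1 / 2) * partialDeriv 0 (ppCoeff H) p else 0 := by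
    ext i j p; exact christoffel_ppWaveMetric_zero i j p
  have h1 : christoffel (ppWaveMetric H) 1 = fun i j p =>
      if i = 2 ∧ j = 2 then -(1 / 2) * partialDeriv 1 (ppCoeff H) p else 0 := by
    ext i j p; exact christoffel_ppWaveMetric_one i j p
  have h2 : christoffel (ppWaveMetric H) 2 = fun _ _ _ => 0 := by
    ext i j p; exact christoffel_ppWaveMetric_two hH i j p
  have h3 : christoffel (ppWaveMetric H) 3 = fun i j p =>
      1 / 2 * ((if j = 2 then partialDeriv i (ppCoeff H) p else 0) +
        (if i = 2 then partialDeriv j (ppCoeff H) p else 0) -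
        if i = 2 ∧ j = 2 then partialDeriv 2 (ppCoeff H) p else 0) := by
    ext i j p; exact christoffel_ppWaveMetric_three hH i j p
  have hmul : ∀ (i j : Fin 4), partialDeriv j (fun p => -(1 / 2) * partialDeriv i (ppCoeff H) p) p =
      -(1 / 2) * partialDeriv j (partialDeriv i (ppCoeff H)) p := fun i j => by
    have hd : DifferentiableAt ℝ (partialDeriv i (ppCoeff H)) p :=
      (contDiff_partialDeriv (contDiff_ppCoeff hH) i).differentiable (by simp) p
    rw [partialDeriv, fderiv_const_mul hd]
    rfl
  simp only [ricci, Fin.sum_univ_four, h0, h1, h2, h3]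
  have h00 := hmul 0 0
  have h11 := hmul 1 1
  have h32 := partialDeriv_three_const_mul_partialDeriv_ppCoeff hH (1 / 2) 2 p
  simp [partialDeriv_const, partialDeriv_three_ppCoeff hH] at h00 h11 h32 ⊢
  linarith

/-- The acceleration of a geodesic of the pp-wave at the point `p` with velocity `w`. -/
noncomputable def ppAccel (H : (Fin 2 → ℝ) × ℝ → ℝ) (p w : Fin 4 → ℝ) : Fin 4 → ℝ :=
  ![1 / 2 * partialDeriv 0 (ppCoeff H) p * w 2 ^ 2,
    1 / 2 * partialDeriv 1 (ppCoeff H) p * w 2 ^ 2,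
    0,
    -(partialDeriv 0 (ppCoeff H) p * w 0 * w 2 + partialDeriv 1 (ppCoeff H) p * w 1 * w 2 +
      1 / 2 * partialDeriv 2 (ppCoeff H) p * w 2 ^ 2)]

theorem neg_sum_christoffel_ppWaveMetric (hH : ContDiff ℝ ∞ H) (p w : Fin 4 → ℝ) :
    (fun k => -∑ i, ∑ j, christoffel (ppWaveMetric H) k i j p * w i * w j) = ppAccel H p w := by
  ext k
  fin_cases k
  · simp [christoffel_ppWaveMetric_zero, Fin.sum_univ_four, ppAccel]; ring
  · simp [christoffel_ppWaveMetric_one, Fin.sum_univ_four, ppAccel]; ring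
  · simp [christoffel_ppWaveMetric_two hH, ppAccel]
  · simp [christoffel_ppWaveMetric_three hH, Fin.sum_univ_four, ppAccel,
      partialDeriv_three_ppCoeff hH]
    ring

theorem contDiff_ppAccel (hH : ContDiff ℝ ∞ H) :
    ContDiff ℝ ∞ (fun x : (Fin 4 → ℝ) × (Fin 4 → ℝ) => ppAccel H x.1 x.2) := by
  have hp : ∀ i, ContDiff ℝ ∞ fun x : (Fin 4 → ℝ) × (Fin 4 → ℝ) =>
      partialDeriv i (ppCoeff H) x.1 :=
    fun i => (contDiff_partialDeriv (contDiff_ppCoeff hH) i).comp contDiff_fst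
  have hw : ∀ i : Fin 4, ContDiff ℝ ∞ fun x : (Fin 4 → ℝ) × (Fin 4 → ℝ) => x.2 i :=
    fun i => (contDiff_apply ℝ ℝ i).comp contDiff_snd
  refine contDiff_pi.2 fun k => ?_
  fin_cases k
  · exact (contDiff_const.mul (hp 0)).mul ((hw 2).pow 2)
  · exact (contDiff_const.mul (hp 1)).mul ((hw 2).pow 2)
  · exact contDiff_const
  · exact ((((hp 0).mul (hw 0)).mul (hw 2)).add (((hp 1).mul (hw 1)).mul (hw 2))).add
      ((contDiff_const.mul (hp 2)).mul ((hw 2).pow 2)) |>.neg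

theorem isGeodesicOn_ppWaveMetric_iff (hH : ContDiff ℝ ∞ H) {γ : ℝ → Fin 4 → ℝ} {I : Set ℝ} :
    IsGeodesicOn (ppWaveMetric H) γ I ↔ ∀ s ∈ I, HasDerivAt γ (deriv γ s) s ∧
      HasDerivAt (deriv γ) (ppAccel H (γ s) (deriv γ s)) s := by
  simp only [IsGeodesicOn, neg_sum_christoffel_ppWaveMetric hH, hasDerivAt_deriv_iff]

end PPWave

/-! ### The gradient of the coefficient as a holomorphic function -/

/-- The point of `ℝ⁴` with `x + i y = z`, the given `u`, and `v = 0`. -/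
def ppPoint (z : ℂ) (u : ℝ) : Fin 4 → ℝ := ![z.re, z.im, u, 0]

/-- The complex number `x + i y` formed from the first two coordinates. -/
def planePart (p : Fin 4 → ℝ) : ℂ := ⟨p 0, p 1⟩

/-- The gradient of `H(·, u)` in the complex form `∂ₓH - i ∂ᵧH`. -/
noncomputable def ppGradient (H : (Fin 2 → ℝ) × ℝ → ℝ) (z : ℂ) (u : ℝ) : ℂ :=
  partialDeriv 0 (ppCoeff H) (ppPoint z u) - Complex.I * partialDeriv 1 (ppCoeff H) (ppPoint z u)

/-- The coefficient of `zᵏ` in the Taylor expansion of `ppGradient H z u` in `z` at `0`. -/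
noncomputable def ppTaylorCoeff (H : (Fin 2 → ℝ) × ℝ → ℝ) (k : ℕ) (u : ℝ) : ℂ :=
  (k.factorial : ℂ)⁻¹ * iteratedDeriv k (fun z => ppGradient H z u) 0

section Slices

variable {H : (Fin 2 → ℝ) × ℝ → ℝ}

theorem hasFDerivAt_ppPoint (z : ℂ) (u : ℝ) :
    HasFDerivAt (fun z => ppPoint z u)
      (ContinuousLinearMap.pi ![Complex.reCLM, Complex.imCLM, 0, 0]) z := by
  refine hasFDerivAt_pi.2 fun i => ?_
  fin_cases i
  · exact Complex.reCLM.hasFDerivAt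
  · exact Complex.imCLM.hasFDerivAt
  · exact hasFDerivAt_const u z
  · exact hasFDerivAt_const 0 z

theorem contDiff_ppPoint (u : ℝ) : ContDiff ℝ ∞ (fun z => ppPoint z u) := by
  refine contDiff_pi.2 fun i => ?_
  fin_cases i
  · exact Complex.reCLM.contDiff
  · exact Complex.imCLM.contDiff
  · exact contDiff_const
  · exact contDiff_const

theorem continuous_ppPoint : Continuous fun p : ℂ × ℝ => ppPoint p.1 p.2 := by
  refine continuous_pi fun i => ?_
  fin_cases i
  · exact Complex.continuous_re.comp continuous_fst
  · exact Complex.continuous_im.comp continuous_fst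
  · exact continuous_snd
  · exact continuous_const

theorem fderiv_comp_ppPoint {K : (Fin 4 → ℝ) → ℝ} (hK : Differentiable ℝ K) (z : ℂ) (u : ℝ) :
    fderiv ℝ (fun z => K (ppPoint z u)) z 1 = partialDeriv 0 K (ppPoint z u) ∧
    fderiv ℝ (fun z => K (ppPoint z u)) z Complex.I = partialDeriv 1 K (ppPoint z u) := by
  have h := (hK (ppPoint z u)).hasFDerivAt.comp z (hasFDerivAt_ppPoint z u)
  have h' : fderiv ℝ (fun z => K (ppPoint z u)) z = _ := h.fderiv
  rw [h']
  refine ⟨congrArg (fderiv ℝ K (ppPoint z u)) ?_, congrArg (fderiv ℝ K (ppPoint z u)) ?_⟩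
  · ext i; fin_cases i <;> simp
  · ext i; fin_cases i <;> simp

open InnerProductSpace in
/-- In a Ricci flat pp-wave the functions `H(·, u)` are harmonic. -/
theorem harmonicOnNhd_ppCoeff (hH : ContDiff ℝ ∞ H) (hR : IsRicciFlat (ppWaveMetric H)) (u : ℝ) :
    HarmonicOnNhd (fun z => ppCoeff H (ppPoint z u)) Set.univ := by
  have hsm : ContDiff ℝ ∞ (fun z => ppCoeff H (ppPoint z u)) :=
    (contDiff_ppCoeff hH).comp (contDiff_ppPoint u)
  have hd0 : Differentiable ℝ (ppCoeff H) := (contDiff_ppCoeff hH).differentiable (by simp)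
  have hd : ∀ i, Differentiable ℝ (partialDeriv i (ppCoeff H)) := fun i =>
    (contDiff_partialDeriv (contDiff_ppCoeff hH) i).differentiable (by simp)
  intro z _
  refine ⟨(hsm.of_le (by norm_cast)).contDiffAt, Filter.Eventually.of_forall
    fun w => ?_⟩
  have hdf : DifferentiableAt ℝ (fderiv ℝ fun z => ppCoeff H (ppPoint z u)) w :=
    (hsm.fderiv_right (m := ∞) (by norm_cast)).differentiable (by simp) w
  have h2 : ∀ e : ℂ, fderiv ℝ (fderiv ℝ fun z => ppCoeff H (ppPoint z u)) w e e =
      fderiv ℝ (fun z => fderiv ℝ (fun z => ppCoeff H (ppPoint z u)) z e) w e := fun e => by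
    rw [fderiv_clm_apply hdf (by fun_prop)]
    simp
  have hric := hR (ppPoint w u) 2 2
  rw [ricci_ppWaveMetric_two_two hH] at hric
  simp only [laplacian_eq_iteratedFDeriv_complexPlane, iteratedFDeriv_two_apply,
    Matrix.cons_val_zero, Matrix.cons_val_one, Pi.zero_apply, h2]
  simp only [(fderiv_comp_ppPoint hd0 _ u).1, (fderiv_comp_ppPoint hd0 _ u).2]
  rw [(fderiv_comp_ppPoint (hd 0) w u).1, (fderiv_comp_ppPoint (hd 1) w u).2]
  linarith

theorem continuous_ppGradient (hH : ContDiff ℝ ∞ H) :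
    Continuous (Function.uncurry (ppGradient H)) := by
  have h : ∀ i, Continuous fun p : ℂ × ℝ =>
      ((partialDeriv i (ppCoeff H) (ppPoint p.1 p.2) : ℝ) : ℂ) := fun i =>
    Complex.continuous_ofReal.comp
      ((contDiff_partialDeriv (contDiff_ppCoeff hH) i).continuous.comp continuous_ppPoint)
  exact (h 0).sub (continuous_const.mul (h 1))

/-- In a Ricci flat pp-wave the function `H(·, u)` is the real part of an entire function with
derivative `ppGradient H · u`. -/
theorem exists_potential (hH : ContDiff ℝ ∞ H) (hR : IsRicciFlat (ppWaveMetric H)) (u : ℝ) :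
    ∃ F : ℂ → ℂ, Differentiable ℂ F ∧ (∀ z, (F z).re = ppCoeff H (ppPoint z u)) ∧
      deriv F = fun z => ppGradient H z u := by
  obtain ⟨F, hF, hre, hder⟩ := exists_re_eq_and_deriv_eq_of_harmonic (harmonicOnNhd_ppCoeff hH hR u)
  refine ⟨F, hF, hre, hder.trans ?_⟩
  have hd : Differentiable ℝ (ppCoeff H) := (contDiff_ppCoeff hH).differentiable (by simp)
  ext z
  rw [(fderiv_comp_ppPoint hd z u).1, (fderiv_comp_ppPoint hd z u).2, ppGradient]

theorem differentiable_ppGradient (hH : ContDiff ℝ ∞ H) (hR : IsRicciFlat (ppWaveMetric H))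
    (u : ℝ) : Differentiable ℂ fun z => ppGradient H z u := by
  obtain ⟨F, hF, -, hder⟩ := exists_potential hH hR u
  rw [← hder]
  exact (hF.contDiff (n := 2)).differentiable_deriv_two

theorem continuous_ppTaylorCoeff (hH : ContDiff ℝ ∞ H) (hR : IsRicciFlat (ppWaveMetric H)) (k : ℕ) :
    Continuous (ppTaylorCoeff H k) :=
  continuous_const.mul (continuous_iteratedDeriv_of_differentiable (continuous_ppGradient hH)
    (differentiable_ppGradient hH hR) k)

/-- If `H(·, u)` is bounded above by a polynomial of degree `N`, then its gradient is a polynomial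
of degree less than `N`. -/
theorem ppTaylorCoeff_eq_zero (hH : ContDiff ℝ ∞ H) (hR : IsRicciFlat (ppWaveMetric H)) {u : ℝ}
    {q : MvPolynomial (Fin 2) ℝ} (hq : ∀ z, H (z, u) ≤ MvPolynomial.eval z q) {k : ℕ}
    (hk : q.totalDegree ≤ k) : ppTaylorCoeff H k u = 0 := by
  obtain ⟨C, hC0, hC⟩ := q.exists_abs_eval_le
  obtain ⟨F, hF, hre, hder⟩ := exists_potential hH hR u
  rw [ppTaylorCoeff, ← hder, ← iteratedDeriv_succ', iteratedDeriv_eq_zero_of_re_le hF (C := C)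
    (N := q.totalDegree) (fun z => ?_) (by omega), mul_zero]
  rw [hre]
  calc ppCoeff H (ppPoint z u) ≤ MvPolynomial.eval ![z.re, z.im] q := hq _
    _ ≤ C * (1 + ‖![z.re, z.im]‖) ^ q.totalDegree := (le_abs_self _).trans (hC _)
    _ ≤ C * (1 + ‖z‖) ^ q.totalDegree := by
        gcongr
        refine (pi_norm_le_iff_of_nonneg (norm_nonneg z)).2 fun i => ?_
        fin_cases i
        · exact Complex.abs_re_le_norm z
        · exact Complex.abs_im_le_norm z

theorem ppGradient_eq_sum (hH : ContDiff ℝ ∞ H) (hR : IsRicciFlat (ppWaveMetric H)) {u : ℝ} {N : ℕ}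
    (h : ∀ k, N ≤ k → ppTaylorCoeff H k u = 0) (z : ℂ) :
    ppGradient H z u = ∑ k ∈ Finset.range N, ppTaylorCoeff H k u * z ^ k := by
  refine eq_sum_of_iteratedDeriv_eq_zero (differentiable_ppGradient hH hR u) (fun k hk => ?_) z
  exact (mul_eq_zero.1 (h k hk)).resolve_left (by simp [Nat.factorial_ne_zero])

/-- If the gradients of all functions `H(·, u)` are affine in `z`, then the pp-wave is a plane
wave. -/
theorem isPlaneWave_of_ppTaylorCoeff_eq_zero (hH : ContDiff ℝ ∞ H)
    (hR : IsRicciFlat (ppWaveMetric H)) (h : ∀ k u, 2 ≤ k → ppTaylorCoeff H k u = 0) :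
    IsPlaneWave H := by
  intro u
  obtain ⟨F, hF, hre, hder⟩ := exists_potential hH hR u
  have hzero : ∀ k, 3 ≤ k → iteratedDeriv k F 0 = 0 := by
    intro k hk
    obtain ⟨j, rfl⟩ : ∃ j, k = j + 1 := ⟨k - 1, by omega⟩
    rw [iteratedDeriv_succ', hder]
    exact (mul_eq_zero.1 (h j u (by omega))).resolve_left (by simp [Nat.factorial_ne_zero])
  obtain ⟨c, hsum⟩ : ∃ c : ℕ → ℂ, ∀ z, F z = ∑ k ∈ Finset.range 3, c k * z ^ k :=
    ⟨_, eq_sum_of_iteratedDeriv_eq_zero hF hzero⟩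
  open MvPolynomial in
  refine ⟨C (c 0).re + (c 1).re • X 0 + (-(c 1).im) • X 1 + (c 2).re • (X 0 * X 0) +
    (-(c 2).re) • (X 1 * X 1) + (-(2 * (c 2).im)) • (X 0 * X 1), ?_, fun z => ?_⟩
  · have hX : ∀ i j : Fin 2, (X i * X j : MvPolynomial (Fin 2) ℝ).totalDegree ≤ 2 := fun i j =>
      (totalDegree_mul _ _).trans (by rw [totalDegree_X, totalDegree_X])
    have hX1 : ∀ i : Fin 2, (X i : MvPolynomial (Fin 2) ℝ).totalDegree ≤ 2 := fun i => by
      rw [totalDegree_X]; norm_num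
    have hadd : ∀ p q : MvPolynomial (Fin 2) ℝ, p.totalDegree ≤ 2 → q.totalDegree ≤ 2 →
        (p + q).totalDegree ≤ 2 := fun p q hp hq => (totalDegree_add p q).trans (max_le hp hq)
    have hsmul : ∀ (a : ℝ) (p : MvPolynomial (Fin 2) ℝ), p.totalDegree ≤ 2 →
        (a • p).totalDegree ≤ 2 := fun a p hp => (totalDegree_smul_le a p).trans hp
    exact hadd _ _ (hadd _ _ (hadd _ _ (hadd _ _ (hadd _ _ (by simp) (hsmul _ _ (hX1 0)))
      (hsmul _ _ (hX1 1))) (hsmul _ _ (hX 0 0))) (hsmul _ _ (hX 1 1))) (hsmul _ _ (hX 0 1))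
  · have h1 : H (z, u) = (F ⟨z 0, z 1⟩).re := by
      rw [hre]
      have : z = ![z 0, z 1] := by ext i; fin_cases i <;> rfl
      rw [this]; rfl
    rw [h1, hsum]
    simp [Finset.sum_range_succ, pow_two]
    ring

end Slices

/-! ### Completeness -/

section Geodesics

variable {H : (Fin 2 → ℝ) × ℝ → ℝ}

theorem hasDerivAt_planePart {γ : ℝ → Fin 4 → ℝ} {w : Fin 4 → ℝ} {s : ℝ} (h : HasDerivAt γ w s) :
    HasDerivAt (fun s => planePart (γ s)) (planePart w) s := by
  have h1 := hasDerivAt_pi.1 h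
  have h2 := (h1 0).ofReal_comp.add ((h1 1).ofReal_comp.mul_const Complex.I)
  have h3 : ∀ p : Fin 4 → ℝ, planePart p = p 0 + p 1 * Complex.I := fun p =>
    Complex.mk_eq_add_mul_I _ _
  simp only [h3]
  exact h2

theorem partialDeriv_ppCoeff_congr (i : Fin 4) {p p' : Fin 4 → ℝ} (h0 : p 0 = p' 0)
    (h1 : p 1 = p' 1) (h2 : p 2 = p' 2) :
    partialDeriv i (ppCoeff H) p = partialDeriv i (ppCoeff H) p' := by
  have h : p = p' + (p 3 - p' 3) • Pi.single 3 1 := by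
    ext j; fin_cases j <;> simp [h0, h1, h2]
  rw [h, partialDeriv, ← fderiv_comp_add_right]
  simp only [ppCoeff_add_smul_single_three]
  rfl

theorem ppAccel_congr {p p' w w' : Fin 4 → ℝ} (h0 : p 0 = p' 0) (h1 : p 1 = p' 1)
    (h2 : p 2 = p' 2) (k0 : w 0 = w' 0) (k1 : w 1 = w' 1) (k2 : w 2 = w' 2) :
    ppAccel H p w = ppAccel H p' w' := by
  simp only [ppAccel, partialDeriv_ppCoeff_congr (H := H) _ h0 h1 h2, k0, k1, k2]

/-- The plane part of the geodesic equation of a pp-wave. -/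
theorem planePart_ppAccel (p w : Fin 4 → ℝ) :
    planePart (ppAccel H p w) =
      1 / 2 * (w 2 : ℂ) ^ 2 * (starRingEnd ℂ) (ppGradient H (planePart p) (p 2)) := by
  have h : ∀ i, partialDeriv i (ppCoeff H) (ppPoint (planePart p) (p 2)) =
      partialDeriv i (ppCoeff H) p := fun i => partialDeriv_ppCoeff_congr i rfl rfl rfl
  have hw : (1 / 2 * (w 2 : ℂ) ^ 2) = ((1 / 2 * w 2 ^ 2 : ℝ) : ℂ) := by push_cast; ring
  rw [ppGradient, h, h, hw]
  apply Complex.ext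
  · rw [Complex.re_ofReal_mul]; simp [planePart, ppAccel]; ring
  · rw [Complex.im_ofReal_mul]; simp [planePart, ppAccel]; ring

theorem isGeodesicOn_of_hasDerivAt (hH : ContDiff ℝ ∞ H) {γ γ' : ℝ → Fin 4 → ℝ} {I : Set ℝ}
    (hI : IsOpen I) (h : ∀ s ∈ I, HasDerivAt γ (γ' s) s ∧ HasDerivAt γ' (ppAccel H (γ s) (γ' s)) s) :
    IsGeodesicOn (ppWaveMetric H) γ I := by
  refine (isGeodesicOn_ppWaveMetric_iff hH).2 fun s hs => ?_
  have hev : deriv γ =ᶠ[nhds s] γ' := by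
    filter_upwards [hI.mem_nhds hs] with t ht using (h t ht).1.deriv
  rw [hev.eq_of_nhds]
  exact ⟨(h s hs).1, (h s hs).2.congr_of_eventuallyEq hev⟩

/-- Short geodesics with prescribed initial data exist. -/
theorem exists_isGeodesicOn_Ioo (hH : ContDiff ℝ ∞ H) (p w : Fin 4 → ℝ) :
    ∃ ε > 0, ∃ γ : ℝ → Fin 4 → ℝ, IsGeodesicOn (ppWaveMetric H) γ (Set.Ioo (-ε) ε) ∧
      γ 0 = p ∧ deriv γ 0 = w := by
  have hsm : ContDiffAt ℝ 1 (fun x : (Fin 4 → ℝ) × (Fin 4 → ℝ) => (x.2, ppAccel H x.1 x.2))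
      (p, w) :=
    ((contDiff_snd.prodMk (contDiff_ppAccel hH)).of_le (by norm_cast)).contDiffAt
  obtain ⟨α, hα0, ε, hε, hα⟩ :=
    hsm.exists_forall_mem_closedBall_exists_eq_forall_mem_Ioo_hasDerivAt₀ 0
  rw [zero_sub, zero_add] at hα
  have hd : ∀ s ∈ Set.Ioo (-ε) ε, HasDerivAt (fun s => (α s).1) (α s).2 s ∧
      HasDerivAt (fun s => (α s).2) (ppAccel H (α s).1 (α s).2) s := fun s hs =>
    ⟨(hα s hs).fst, (hα s hs).snd⟩
  refine ⟨ε, hε, fun s => (α s).1, isGeodesicOn_of_hasDerivAt hH isOpen_Ioo hd, by simp only [hα0], ?_⟩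
  rw [(hd 0 ⟨by linarith, hε⟩).1.deriv, hα0]

/-- Along a geodesic of a pp-wave the coordinate `u` is an affine function. -/
theorem IsGeodesicOn.coord_two_affine (hH : ContDiff ℝ ∞ H) {γ : ℝ → Fin 4 → ℝ} {I : Set ℝ}
    (hI : IsOpen I) (hI' : I.OrdConnected) (hγ : IsGeodesicOn (ppWaveMetric H) γ I) {s₀ : ℝ}
    (hs₀ : s₀ ∈ I) : ∀ s ∈ I, deriv γ s 2 = deriv γ s₀ 2 ∧
      γ s 2 = γ s₀ 2 + deriv γ s₀ 2 * (s - s₀) := by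
  rw [isGeodesicOn_ppWaveMetric_iff hH] at hγ
  have h1 : ∀ s ∈ I, HasDerivAt (fun s => deriv γ s 2) 0 s := fun s hs =>
    hasDerivAt_pi.1 (hγ s hs).2 2
  have h2 : ∀ s ∈ I, HasDerivAt (fun s => γ s 2) (deriv γ s 2) s := fun s hs =>
    hasDerivAt_pi.1 (hγ s hs).1 2
  have hpre := hI'.isPreconnected
  have hconst : ∀ s ∈ I, deriv γ s 2 = deriv γ s₀ 2 := fun s hs =>
    hI.is_const_of_deriv_eq_zero hpre (fun t ht => (h1 t ht).differentiableAt.differentiableWithinAt)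
      (fun t ht => (h1 t ht).deriv) hs hs₀
  have h3 : ∀ s, HasDerivAt (fun s => γ s₀ 2 + deriv γ s₀ 2 * (s - s₀)) (deriv γ s₀ 2) s := fun s => by
    simpa using (((hasDerivAt_id s).sub_const s₀).const_mul (deriv γ s₀ 2)).const_add (γ s₀ 2)
  refine fun s hs => ⟨hconst s hs, ?_⟩
  refine hI.eqOn_of_deriv_eq hpre (f := fun s => γ s 2)
    (fun t ht => (h2 t ht).differentiableAt.differentiableWithinAt)
    (fun t _ => (h3 t).differentiableAt.differentiableWithinAt)
    (fun t ht => by rw [(h2 t ht).deriv, (h3 t).deriv, hconst t ht]) hs₀ (by simp) hs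

/-- If some gradient `ppGradient H · u₁` has a nonzero Taylor coefficient of order at least `2`,
then the pp-wave is incomplete. -/
theorem ppTaylorCoeff_eq_zero_of_complete (hH : ContDiff ℝ ∞ H) (hbound : PolynomiallyUBounded H)
    (hR : IsRicciFlat (ppWaveMetric H)) (hc : IsGeodesicallyComplete (ppWaveMetric H)) {k : ℕ}
    {u₁ : ℝ} (hk : 2 ≤ k) : ppTaylorCoeff H k u₁ = 0 := by
  by_contra hne
  obtain ⟨ε, hε, q, hq⟩ := hbound u₁
  set J := Set.Ioo (u₁ - ε) (u₁ + ε) with hJ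
  have hzero : ∀ j, q.totalDegree ≤ j → ∀ u ∈ J, ppTaylorCoeff H j u = 0 := fun j hj u hu =>
    ppTaylorCoeff_eq_zero hH hR (fun z => hq z u hu) hj
  -- `n` is the largest order of a coefficient that does not vanish identically near `u₁`.
  classical
  set Q : ℕ → Prop := fun j => ∃ u ∈ J, ppTaylorCoeff H j u ≠ 0 with hQ
  have hQk : Q k := ⟨u₁, ⟨by linarith, by linarith⟩, hne⟩
  have hbd : ∀ j, Q j → j ≤ q.totalDegree := fun j ⟨u, hu, hj⟩ => by
    by_contra! h
    exact hj (hzero j h.le u hu)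
  set n := Nat.findGreatest Q q.totalDegree with hn
  have hkn : k ≤ n := Nat.le_findGreatest (hbd k hQk) hQk
  obtain ⟨u₀, hu₀, hn0⟩ : Q n := Nat.findGreatest_spec (hbd k hQk) hQk
  have htop : ∀ j, n + 1 ≤ j → ∀ u ∈ J, ppTaylorCoeff H j u = 0 := by
    intro j hj u hu
    by_contra h
    have hQj : Q j := ⟨u, hu, h⟩
    have := Nat.le_findGreatest (hbd j hQj) hQj
    omega
  obtain ⟨δ, hδ, hδJ⟩ : ∃ δ > 0, ∀ s ∈ Set.Icc 0 δ, u₀ + s ∈ J := by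
    refine ⟨(u₁ + ε - u₀) / 2, by linarith [hu₀.2], fun s hs => ⟨?_, ?_⟩⟩
    · linarith [hu₀.1, hs.1]
    · linarith [hu₀.2, hs.2]
  obtain ⟨z₀, z₁, hfalse⟩ := exists_initial_data_false (n := n) (by omega)
    (b := fun j s => ppTaylorCoeff H j (u₀ + s))
    (fun j => ((continuous_ppTaylorCoeff hH hR j).comp (continuous_const_add u₀)).continuousAt)
    (by simpa using hn0) hδ
  obtain ⟨r, hr, γ₀, hγ₀, hp, hw⟩ := exists_isGeodesicOn_Ioo hH (ppPoint z₀ u₀)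
    (![z₁.re, z₁.im, 1, 0])
  have h0 : (0 : ℝ) ∈ Set.Ioo (-r) r := ⟨by linarith, hr⟩
  obtain ⟨γ, hγ, heq⟩ := hc _ γ₀ isOpen_Ioo Set.ordConnected_Ioo ⟨0, h0⟩ hγ₀
  have hγ0 : γ 0 = ppPoint z₀ u₀ := (heq h0).trans hp
  have hev : γ =ᶠ[nhds 0] γ₀ := heq.eventuallyEq_of_mem (isOpen_Ioo.mem_nhds h0)
  have hγ'0 : deriv γ 0 = ![z₁.re, z₁.im, 1, 0] := hev.deriv_eq.trans hw
  have haff := hγ.coord_two_affine hH isOpen_univ Set.ordConnected_univ (s₀ := 0) trivial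
  rw [isGeodesicOn_ppWaveMetric_iff hH] at hγ
  refine hfalse (fun s => planePart (γ s)) (fun s => planePart (deriv γ s))
    (by simp only [hγ0]; rfl) (by simp only [hγ'0]; rfl) fun s hs => ?_
  obtain ⟨h1, h2⟩ := hγ s trivial
  refine ⟨hasDerivAt_planePart h1, (hasDerivAt_planePart h2).congr_deriv ?_⟩
  have hu : γ s 2 = u₀ + s := by
    rw [(haff s trivial).2, hγ0, hγ'0]; simp [ppPoint]
  have hu' : deriv γ s 2 = 1 := by
    rw [(haff s trivial).1, hγ'0]; simp
  rw [planePart_ppAccel, hu, hu', ppGradient_eq_sum hH hR fun j hj => htop j hj _ (hδJ s hs)]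
  simp

/-- If the gradients of all functions `H(·, u)` are affine in `z`, then the geodesic equation for
`z` is linear, so that its solutions are global, and `v` is obtained by two integrations. -/
theorem isGeodesicallyComplete_of_ppTaylorCoeff_eq_zero (hH : ContDiff ℝ ∞ H)
    (hR : IsRicciFlat (ppWaveMetric H)) (h : ∀ k u, 2 ≤ k → ppTaylorCoeff H k u = 0) :
    IsGeodesicallyComplete (ppWaveMetric H) := by
  rintro I γ hI hI' ⟨s₀, hs₀⟩ hγ
  have haff := hγ.coord_two_affine hH hI hI' hs₀
  rw [isGeodesicOn_ppWaveMetric_iff hH] at hγ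
  set Δ := deriv γ s₀ 2 with hΔ
  set u : ℝ → ℝ := fun s => γ s₀ 2 + Δ * (s - s₀) with hu
  have hgrad : ∀ z t, ppGradient H z t = ppTaylorCoeff H 0 t + ppTaylorCoeff H 1 t * z := by
    intro z t
    rw [ppGradient_eq_sum hH hR (fun k hk => h k t hk)]
    simp [Finset.sum_range_succ]
  set f : ℝ → ℂ × ℂ → ℂ × ℂ := fun s x =>
    (x.2, 1 / 2 * (Δ : ℂ) ^ 2 * (starRingEnd ℂ) (ppGradient H x.1 (u s))) with hf
  have hucont : Continuous u := by fun_prop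
  have hfc : ∀ x, Continuous fun s => f s x := fun x =>
    continuous_const.prodMk (continuous_const.mul (Complex.continuous_conj.comp
      ((continuous_ppGradient hH).comp (continuous_const.prodMk hucont))))
  have hfL : ∀ a b : ℝ, ∃ K : NNReal, ∀ s ∈ Set.Icc a b, LipschitzWith K (f s) := by
    intro a b
    obtain ⟨B, hB⟩ := (isCompact_Icc (a := a) (b := b)).exists_bound_of_continuousOn
      ((continuous_ppTaylorCoeff hH hR 1).comp hucont).continuousOn
    refine ⟨1 + ⟨1 / 2 * Δ ^ 2 * |B|, by positivity⟩, fun s hs =>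
      LipschitzWith.of_dist_le_mul fun x y => ?_⟩
    rw [dist_eq_norm, dist_eq_norm]
    have hx1 : ‖(x - y).1‖ ≤ ‖x - y‖ := norm_fst_le _
    have hx2 : ‖(x - y).2‖ ≤ ‖x - y‖ := norm_snd_le _
    have h0 : 0 ≤ ‖x - y‖ := norm_nonneg _
    change _ ≤ (1 + 1 / 2 * Δ ^ 2 * |B|) * ‖x - y‖
    refine (Prod.norm_def _).le.trans (max_le ?_ ?_)
    · change ‖(x - y).2‖ ≤ _
      have : 0 ≤ 1 / 2 * Δ ^ 2 * |B| * ‖x - y‖ := by positivity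
      linarith
    · have h1 : (f s x - f s y).2 = 1 / 2 * (Δ : ℂ) ^ 2 *
          (starRingEnd ℂ) (ppTaylorCoeff H 1 (u s) * (x - y).1) := by
        simp only [hf, hgrad, Prod.snd_sub, Prod.fst_sub, map_add, map_mul, map_sub]
        ring
      have hBs : ‖ppTaylorCoeff H 1 (u s)‖ ≤ |B| := (hB s hs).trans (le_abs_self B)
      have h2 : ‖(1 / 2 * (Δ : ℂ) ^ 2)‖ = 1 / 2 * Δ ^ 2 := by
        rw [norm_mul, norm_pow, Complex.norm_real, Real.norm_eq_abs, sq_abs]; simp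
      rw [h1, norm_mul, h2, RCLike.norm_conj, norm_mul]
      calc 1 / 2 * Δ ^ 2 * (‖ppTaylorCoeff H 1 (u s)‖ * ‖(x - y).1‖)
          ≤ 1 / 2 * Δ ^ 2 * (|B| * ‖x - y‖) := by gcongr
        _ ≤ (1 + 1 / 2 * Δ ^ 2 * |B|) * ‖x - y‖ := by linarith
  obtain ⟨α, hα0, hα⟩ := exists_solution_of_lipschitzWith (t₀ := s₀) hfc
    (fun T => hfL (s₀ - T) (s₀ + T)) (planePart (γ s₀), planePart (deriv γ s₀))
  -- Uniqueness: the given geodesic follows the global solution.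
  have hβ : ∀ s ∈ I, HasDerivAt (fun s => (planePart (γ s), planePart (deriv γ s)))
      (f s (planePart (γ s), planePart (deriv γ s))) s := by
    intro s hs
    obtain ⟨h1, h2⟩ := hγ s hs
    refine ((hasDerivAt_planePart h1).prodMk (hasDerivAt_planePart h2)).congr_deriv ?_
    rw [planePart_ppAccel, (haff s hs).1, (haff s hs).2]
  have hagree : ∀ s ∈ I, (planePart (γ s), planePart (deriv γ s)) = α s := by
    intro s hs
    obtain ⟨a, ha, haI⟩ : ∃ a, a < min s s₀ ∧ a ∈ I := by
      have hmin : min s s₀ ∈ I := by rcases min_choice s s₀ with h | h <;> rw [h] <;> assumption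
      obtain ⟨r, hr, hball⟩ := Metric.isOpen_iff.1 hI _ hmin
      refine ⟨min s s₀ - r / 2, by linarith, hball ?_⟩
      rw [Metric.mem_ball, Real.dist_eq, sub_sub_cancel_left, abs_neg, abs_of_pos] <;> linarith
    obtain ⟨b, hb, hbI⟩ : ∃ b, max s s₀ < b ∧ b ∈ I := by
      have hmax : max s s₀ ∈ I := by rcases max_choice s s₀ with h | h <;> rw [h] <;> assumption
      obtain ⟨r, hr, hball⟩ := Metric.isOpen_iff.1 hI _ hmax
      refine ⟨max s s₀ + r / 2, by linarith, hball ?_⟩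
      rw [Metric.mem_ball, Real.dist_eq, add_sub_cancel_left, abs_of_pos] <;> linarith
    obtain ⟨ha1, ha2⟩ := lt_min_iff.1 ha
    obtain ⟨hb1, hb2⟩ := max_lt_iff.1 hb
    obtain ⟨K, hK⟩ := hfL a b
    exact ODE_solution_unique_of_mem_Ioo (v := f) (s := fun _ => Set.univ) (K := K) (t₀ := s₀)
      (fun t ht => (hK t (Set.Ioo_subset_Icc_self ht)).lipschitzOnWith) ⟨ha2, hb2⟩
      (fun t ht => ⟨hβ t (hI'.out haI hbI (Set.Ioo_subset_Icc_self ht)), trivial⟩)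
      (fun t _ => ⟨hα t, trivial⟩) hα0.symm ⟨ha1, hb1⟩
  -- The coordinate `v` by quadrature.
  have hαc : Continuous α := continuous_iff_continuousAt.2 fun s => (hα s).continuousAt
  set A : ℝ → ℝ := fun s => ppAccel H (ppPoint (α s).1 (u s)) (ppPoint (α s).2 Δ) 3 with hA
  have hAc : Continuous A := by
    have h1 : Continuous fun s => ppPoint (α s).1 (u s) :=
      continuous_ppPoint.comp ((continuous_fst.comp hαc).prodMk hucont)
    have h2 : Continuous fun s => ppPoint (α s).2 Δ :=
      continuous_ppPoint.comp ((continuous_snd.comp hαc).prodMk continuous_const)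
    exact (continuous_apply 3).comp ((contDiff_ppAccel hH).continuous.comp (h1.prodMk h2))
  set W : ℝ → ℝ := fun s => deriv γ s₀ 3 + ∫ t in s₀..s, A t with hW
  have hWd : ∀ s, HasDerivAt W (A s) s := fun s =>
    (intervalIntegral.integral_hasDerivAt_right (hAc.intervalIntegrable _ _)
      (hAc.stronglyMeasurableAtFilter _ _) hAc.continuousAt).const_add _
  have hWc : Continuous W := continuous_iff_continuousAt.2 fun s => (hWd s).continuousAt
  set V : ℝ → ℝ := fun s => γ s₀ 3 + ∫ t in s₀..s, W t with hV
  have hVd : ∀ s, HasDerivAt V (W s) s := fun s =>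
    (intervalIntegral.integral_hasDerivAt_right (hWc.intervalIntegrable _ _)
      (hWc.stronglyMeasurableAtFilter _ _) hWc.continuousAt).const_add _
  have hpre := hI'.isPreconnected
  have hcoord : ∀ s ∈ I, γ s 0 = (α s).1.re ∧ γ s 1 = (α s).1.im ∧
      deriv γ s 0 = (α s).2.re ∧ deriv γ s 1 = (α s).2.im := by
    intro s hs
    rw [← hagree s hs]
    exact ⟨rfl, rfl, rfl, rfl⟩
  have hγ3 : ∀ s ∈ I, HasDerivAt (fun s => γ s 3) (deriv γ s 3) s := fun s hs =>
    hasDerivAt_pi.1 (hγ s hs).1 3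
  have hγ3' : ∀ s ∈ I, HasDerivAt (fun s => deriv γ s 3) (A s) s := by
    intro s hs
    obtain ⟨c0, c1, c0', c1'⟩ := hcoord s hs
    refine (hasDerivAt_pi.1 (hγ s hs).2 3).congr_deriv (congr_fun (ppAccel_congr ?_ ?_ ?_ ?_ ?_ ?_) 3)
    exacts [c0, c1, (haff s hs).2, c0', c1', (haff s hs).1]
  have hW3 : ∀ s ∈ I, deriv γ s 3 = W s :=
    hI.eqOn_of_deriv_eq hpre (f := fun s => deriv γ s 3)
      (fun t ht => (hγ3' t ht).differentiableAt.differentiableWithinAt)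
      (fun t _ => (hWd t).differentiableAt.differentiableWithinAt)
      (fun t ht => by rw [(hγ3' t ht).deriv, (hWd t).deriv]) hs₀ (by simp [hW])
  have hV3 : ∀ s ∈ I, γ s 3 = V s :=
    hI.eqOn_of_deriv_eq hpre (f := fun s => γ s 3)
      (fun t ht => (hγ3 t ht).differentiableAt.differentiableWithinAt)
      (fun t _ => (hVd t).differentiableAt.differentiableWithinAt)
      (fun t ht => by rw [(hγ3 t ht).deriv, (hVd t).deriv, hW3 t ht]) hs₀ (by simp [hV])
  have hre : ∀ {g : ℝ → ℂ} {g' : ℂ} {s : ℝ}, HasDerivAt g g' s →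
      HasDerivAt (fun s => (g s).re) g'.re s :=
    fun hg => Complex.reCLM.hasFDerivAt.comp_hasDerivAt _ hg
  have him : ∀ {g : ℝ → ℂ} {g' : ℂ} {s : ℝ}, HasDerivAt g g' s →
      HasDerivAt (fun s => (g s).im) g'.im s :=
    fun hg => Complex.imCLM.hasFDerivAt.comp_hasDerivAt _ hg
  refine ⟨fun s => ![(α s).1.re, (α s).1.im, u s, V s],
    isGeodesicOn_of_hasDerivAt hH isOpen_univ (γ' := fun s => ![(α s).2.re, (α s).2.im, Δ, W s])
      fun s _ => ⟨?_, ?_⟩, fun s hs => ?_⟩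
  · refine hasDerivAt_pi.2 fun i => ?_
    have h1 : HasDerivAt (fun s => (α s).1) (α s).2 s := (hα s).fst
    fin_cases i
    · exact hre h1
    · exact him h1
    · change HasDerivAt u Δ s
      simpa [hu] using (((hasDerivAt_id s).sub_const s₀).const_mul Δ).const_add (γ s₀ 2)
    · exact hVd s
  · have h2 := (hα s).snd
    have h3 := planePart_ppAccel (H := H) ![(α s).1.re, (α s).1.im, u s, V s]
      ![(α s).2.re, (α s).2.im, Δ, W s]
    have h4 : planePart (ppAccel H ![(α s).1.re, (α s).1.im, u s, V s]
      ![(α s).2.re, (α s).2.im, Δ, W s]) = (f s (α s)).2 := h3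
    refine hasDerivAt_pi.2 fun i => ?_
    fin_cases i
    · exact (hre h2).congr_deriv (congrArg Complex.re h4).symm
    · exact (him h2).congr_deriv (congrArg Complex.im h4).symm
    · exact hasDerivAt_const s Δ
    · have h5 : ppAccel H (ppPoint (α s).1 (u s)) (ppPoint (α s).2 Δ) =
          ppAccel H ![(α s).1.re, (α s).1.im, u s, V s] ![(α s).2.re, (α s).2.im, Δ, W s] :=
        ppAccel_congr rfl rfl rfl rfl rfl rfl
      exact (hWd s).congr_deriv (congr_fun h5 3)
  · obtain ⟨c0, c1, -, -⟩ := hcoord s hs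
    ext i
    fin_cases i
    · exact c0.symm
    · exact c1.symm
    · exact (haff s hs).2.symm
    · exact (hV3 s hs).symm

end Geodesics

theorem mainTheorem2 (H : (Fin 2 → ℝ) × ℝ → ℝ) (hH : ContDiff ℝ ∞ H)
    (hbound : PolynomiallyUBounded H) (hRicci : IsRicciFlat (ppWaveMetric H)) :
    IsGeodesicallyComplete (ppWaveMetric H) ↔ IsPlaneWave H := by
  refine ⟨fun hc => isPlaneWave_of_ppTaylorCoeff_eq_zero hH hRicci fun k u hk =>
    ppTaylorCoeff_eq_zero_of_complete hH hbound hRicci hc hk, fun hp =>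
    isGeodesicallyComplete_of_ppTaylorCoeff_eq_zero hH hRicci fun k u hk => ?_⟩
  obtain ⟨q, hq, hHq⟩ := hp u
  exact ppTaylorCoeff_eq_zero hH hRicci (fun z => (hHq z).le) (hq.trans hk)
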